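/- Let $g,n\ge 0$ be integers with $3g-3+n>0$, let $\Sigma$ be an oriented surface of genus $g$ with $n$ punctures, and let $\gamma_1,\dots,\gamma_n\in\pi_1(\Sigma)$ be loops around the punctures. Let $K$ be a number field with ring of integers $\mathcal O_K$, and let $k=(k_1,\dots,k_n)\in\mathcal O_K^n$. Assume that there is a unit $v\in\mathcal O_K^\times$ that is not a root of unity and such that $v-v^{-1}\in\mathcal O_K^\times$. Then there exist a quadratic extension $L$ of $K$, a pants decomposition $\mathcal P$ of $\Sigma$, and a representation $\rho\colon\pi_1(\Sigma)\to \mathrm{SL}_2(\mathcal O_L)$ such that $\operatorname{tr}\rho(\gamma_j)=k_j$ for $j=1,\dots,n$ and $\rho$ is $\mathcal P$-good. Here a pants decomposition $\mathcal P=\{a_1,\dots,a_{3g-3+n}\}$ of $\Sigma$ is a collection of $3g-3+n$ disjoint simple closed curves whose complement is a disjoint union of pairs of pants (spheres with three punctures), and $\Sigma$ is regarded as glued from these pairs of pants along the curves $a_i$. Let $E$ be the set of numbers $\zeta+\zeta^{-1}$ with $\zeta$ a root of unity. The representation $\rho$ is $\mathcal P$-good if, for every embedding $L\hookrightarrow\mathbb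 C$, with $t_i=\operatorname{tr}\rho(a_i)$ and with $t_i,k_j$ and $E$ regarded in $\mathbb C$, one has $t_i\notin E$ for all $i$ and the fiber $X^{\mathcal P}_{k,t}$, consisting of the representations $\rho'\colon\pi_1(\Sigma)\to\mathrm{SL}_2(\mathbb C)$ with $\operatorname{tr}\rho'(\gamma_j)=k_j$ for all $j$ and $\operatorname{tr}\rho'(a_i)=t_i$ for all $i$, is perfect. That is: 1. for every $\rho'$ in $X^{\mathcal P}_{k,t}$ and every $i$, $\operatorname{tr}\rho'(a_i)\neq\pm2$; and 2. either for every $\rho'$ in $X^{\mathcal P}_{k,t}$ the restriction of $\rho'$ to the fundamental group of each component of $\Sigma\setminus\mathcal P$ is irreducible, or $(g,n,k)=(1,1,2)$. -/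

import Mathlib

open scoped MatrixGroups NumberField

/-! ### The fundamental group of the surface `Σ_{g,n}` -/

/-- The standard generators of `π₁(Σ_{g,n})`: the handle loops `α_i`, `β_i`, and one loop `γ_j`
around each puncture. -/
inductive SurfaceGen (g n : ℕ) : Type
  | alpha (i : Fin g) : SurfaceGen g n
  | beta (i : Fin g) : SurfaceGen g n
  | gamma (j : Fin n) : SurfaceGen g n

/-- The word `[α₁, β₁] ⋯ [α_g, β_g] γ₁ ⋯ γ_n`. -/
def surfaceRelator (g n : ℕ) : FreeGroup (SurfaceGen g n) :=
  (List.ofFn fun i : Fin g =>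
      (FreeGroup.of (SurfaceGen.alpha i : SurfaceGen g n)) * FreeGroup.of (SurfaceGen.beta i) *
        (FreeGroup.of (SurfaceGen.alpha i))⁻¹ * (FreeGroup.of (SurfaceGen.beta i))⁻¹).prod *
    (List.ofFn fun j : Fin n => FreeGroup.of (SurfaceGen.gamma j : SurfaceGen g n)).prod

/-- The fundamental group of an oriented surface of genus `g` with `n` punctures, by its standard
presentation `⟨α_i, β_i, γ_j | [α₁, β₁] ⋯ [α_g, β_g] γ₁ ⋯ γ_n = 1⟩`. -/
abbrev SurfaceGroup (g n : ℕ) : Type :=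
  PresentedGroup ({surfaceRelator g n} : Set (FreeGroup (SurfaceGen g n)))

/-- The loop around the `j`-th puncture, as an element of `π₁(Σ_{g,n})`. -/
def punctureLoop {g n : ℕ} (j : Fin n) : SurfaceGroup g n :=
  PresentedGroup.of (SurfaceGen.gamma j)

/-! ### Surfaces glued from pairs of pants -/

/-- A connected oriented surface glued from finitely many pairs of pants (copies of `Σ_{0,3}`) along
`3g - 3 + n` curves, with `n` boundary components left as punctures.

The three boundary components of the pair of pants `v` are the pairs `(v, 0)`, `(v, 1)`, `(v, 2)`.
Each gluing curve `e` has two sides `side (e, false)` and `side (e, true)` (possibly on the same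
pair of pants), and the `j`-th puncture is the boundary component `leg j`; every boundary component
is used exactly once. As `3 * #Pants = 2 * #Curve + n`, there are `2g - 2 + n` pairs of pants, and
the glued surface, being connected, has genus `g` and `n` punctures.

`tree` is a spanning tree of the dual graph (whose vertices are the pairs of pants and whose edges
are the curves); it expresses connectedness, and serves as the choice of connecting paths that is
needed to write down the fundamental group. -/
structure PantsGluing (g n : ℕ) where
  /-- the pairs of pants -/
  Pants : Type
  /-- the gluing curves `a_e` -/
  Curve : Type
  [fintypePants : Fintype Pants]
  [fintypeCurve : Fintype Curve]
  card_curve : Fintype.card Curve + 3 = 3 * g + n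
  /-- the two sides of each curve -/
  side : Curve × Bool → Pants × Fin 3
  /-- the boundary component at each puncture -/
  leg : Fin n → Pants × Fin 3
  bijective : Function.Bijective (Sum.elim side leg)
  /-- the edges of a spanning tree of the dual graph -/
  tree : Finset Curve
  tree_connected : ∀ v w : Pants,
    Relation.ReflTransGen
      (fun v' w' => ∃ e ∈ tree, ∃ b : Bool, (side (e, b)).1 = v' ∧ (side (e, !b)).1 = w') v w
  tree_card : tree.card + 1 = Fintype.card Pants

attribute [instance] PantsGluing.fintypePants PantsGluing.fintypeCurve

namespace PantsGluing

variable {g n : ℕ} (Γ : PantsGluing g n)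

/-- Generators of the fundamental group of the glued surface: the boundary loops of the pairs of
pants (oriented as boundary, based in their pair of pants), and for every gluing curve a path `t_e`
that crosses it. -/
inductive Gen : Type
  | bdry (h : Γ.Pants × Fin 3) : Gen
  | cross (e : Γ.Curve) : Gen

/-- The defining relations given by the theorem of Seifert and van Kampen:
* `c_{v,0} c_{v,1} c_{v,2} = 1` in each pair of pants `v`;
* `t_e c_h t_e⁻¹ = c_{h'}⁻¹` if the curve `e` has the sides `h` and `h'` (the two sides carry
  opposite boundary orientations, so that the glued surface is oriented);
* `t_e = 1` if `e` lies in the spanning tree. -/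
inductive Rel : FreeGroup Γ.Gen → Prop
  | pants (v : Γ.Pants) :
      Rel (FreeGroup.of (Gen.bdry (v, 0)) * FreeGroup.of (Gen.bdry (v, 1)) *
        FreeGroup.of (Gen.bdry (v, 2)))
  | glue (e : Γ.Curve) :
      Rel (FreeGroup.of (Gen.cross e) * FreeGroup.of (Gen.bdry (Γ.side (e, false))) *
        (FreeGroup.of (Gen.cross e))⁻¹ * FreeGroup.of (Gen.bdry (Γ.side (e, true))))
  | tree (e : Γ.Curve) (he : e ∈ Γ.tree) : Rel (FreeGroup.of (Gen.cross e))

/-- The fundamental group of the glued surface. -/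
abbrev Group : Type := PresentedGroup {r : FreeGroup Γ.Gen | Γ.Rel r}

/-- The loop along the boundary component `h` of a pair of pants, in the group of the surface. -/
def boundaryLoop (h : Γ.Pants × Fin 3) : Γ.Group := PresentedGroup.of (Gen.bdry h)

end PantsGluing

/-! ### Pants decompositions of `Σ_{g,n}` -/

/-- A pants decomposition of `Σ_{g,n}`, up to isotopy: a surface glued from pairs of pants together
with an identification with `Σ_{g,n}` that matches the punctures. The identification is recorded by
its effect on fundamental groups, an isomorphism that takes the loop around the `j`-th puncture to a
conjugate of the loop around the `j`-th puncture (by the theorem of Dehn, Nielsen and Baer these are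
exactly the isomorphisms induced by such identifications of surfaces). -/
structure PantsDecomposition (g n : ℕ) extends PantsGluing g n where
  marking : toPantsGluing.Group ≃* SurfaceGroup g n
  marking_leg : ∀ j : Fin n,
    IsConj (marking (toPantsGluing.boundaryLoop (toPantsGluing.leg j))) (punctureLoop j)

/-- The set `E` of all numbers `ζ + ζ⁻¹` with `ζ` a root of unity. -/
def rootOfUnityTraces : Set ℂ :=
  {z | ∃ ζ : ℂ, (∃ m : ℕ, 0 < m ∧ ζ ^ m = 1) ∧ z = ζ + ζ⁻¹}

/-- The tautological representation of `SL₂(ℂ)` on `ℂ²`. -/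
noncomputable def stdRep : Representation ℂ SL(2, ℂ) (Fin 2 → ℂ) where
  toFun A := Matrix.toLin' (A : Matrix (Fin 2) (Fin 2) ℂ)
  map_one' := by
    rw [Matrix.SpecialLinearGroup.coe_one, Matrix.toLin'_one]
    rfl
  map_mul' A B := by
    rw [Matrix.SpecialLinearGroup.coe_mul, Matrix.toLin'_mul]
    rfl

namespace PantsDecomposition

variable {g n : ℕ} (P : PantsDecomposition g n)

/-- The curve `a_e` of the decomposition, as an element of `π₁(Σ_{g,n})`. As a free homotopy class
it is defined up to conjugation and inversion, which does not affect traces in `SL₂`. -/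
def curve (e : P.Curve) : SurfaceGroup g n :=
  P.marking (P.boundaryLoop (P.side (e, false)))

/-- The fundamental group of the pair of pants `v`, as a subgroup of `π₁(Σ_{g,n})`. -/
def pantsSubgroup (v : P.Pants) : Subgroup (SurfaceGroup g n) :=
  Subgroup.closure (Set.range fun i : Fin 3 => P.marking (P.boundaryLoop (v, i)))

/-- `ρ` represents a complex point of the fiber `X^P_{k,t}`: it has traces `k` at the punctures and
traces `t` along the curves of `P`. -/
def InFiber (k : Fin n → ℂ) (t : P.Curve → ℂ) (ρ : SurfaceGroup g n →* SL(2, ℂ)) : Prop :=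
  (∀ j, (ρ (punctureLoop j) : Matrix (Fin 2) (Fin 2) ℂ).trace = k j) ∧
    ∀ e, (ρ (P.curve e) : Matrix (Fin 2) (Fin 2) ℂ).trace = t e

/-- The restriction of `ρ` to the pair of pants `v` is irreducible. -/
def IrreducibleOn (ρ : SurfaceGroup g n →* SL(2, ℂ)) (v : P.Pants) : Prop :=
  Representation.IsIrreducible (stdRep.comp (ρ.comp (P.pantsSubgroup v).subtype))

/-- The fiber `X^P_{k,t}` is perfect: the traces along the curves of `P` are never `±2` on it, and
either all its points are irreducible on every pair of pants, or `(g, n, k) = (1, 1, 2)`. -/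
def IsPerfectFiber (k : Fin n → ℂ) (t : P.Curve → ℂ) : Prop :=
  (∀ ρ, P.InFiber k t ρ → ∀ e,
    (ρ (P.curve e) : Matrix (Fin 2) (Fin 2) ℂ).trace ≠ 2 ∧
      (ρ (P.curve e) : Matrix (Fin 2) (Fin 2) ℂ).trace ≠ -2) ∧
  ((∀ ρ, P.InFiber k t ρ → ∀ v, P.IrreducibleOn ρ v) ∨ (g = 1 ∧ n = 1 ∧ ∀ j, k j = 2))

/-- `ρ` is `P`-good: no trace along a curve of `P` lies in `E`, and the fiber of `ρ` under the
traces along the punctures and the curves of `P` is perfect. -/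
def IsGood (ρ : SurfaceGroup g n →* SL(2, ℂ)) : Prop :=
  (∀ e, (ρ (P.curve e) : Matrix (Fin 2) (Fin 2) ℂ).trace ∉ rootOfUnityTraces) ∧
  P.IsPerfectFiber (fun j => (ρ (punctureLoop j) : Matrix (Fin 2) (Fin 2) ℂ).trace)
    (fun e => (ρ (P.curve e) : Matrix (Fin 2) (Fin 2) ℂ).trace)

end PantsDecomposition

/-- The complex representation obtained from an integral one by a complex embedding of the number
field. -/
noncomputable def complexRep {g n : ℕ} {L : Type*} [Field L]
    (ρ : SurfaceGroup g n →* SL(2, 𝓞 L)) (σ : L →+* ℂ) : SurfaceGroup g n →* SL(2, ℂ) :=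
  (Matrix.SpecialLinearGroup.map (σ.comp (algebraMap (𝓞 L) L))).comp ρ

/-! The representation is built one gluing at a time, so holonomies must be conjugated and factored
over the ring `𝓞 L`, not merely over a field. This is possible for a trace `t = u + u⁻¹` with `u`
and `u - u⁻¹` units. A regular matrix of such a trace is conjugate to `diag(u, u⁻¹)`
(`exists_conj_eq_diagonal`). Hence it is a product of two regular matrices of arbitrary traces
(`exists_eq_mul`), and two of them are conjugate up to inversion (`exists_eq_conj_inv`). The first
fact extends a representation over a pair of pants glued to a puncture, the second over a handle
made from two punctures. From a single pair of pants one reaches a sphere with `n + 2g` punctures,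
`2g` of them of trace `t`, and sews these in pairs; every decomposing curve gets trace `±t`.

On the topological side, gluing on pants and sewing a handle are described by universal properties
of the surface groups (an amalgam and an HNN extension), which also produce the markings.

Goodness is a condition on traces. On a pair of pants with traces `x, y, z` the polynomial `fricke x
y z` equals `tr [A, B] - 2`, and irreducibility follows when it is nonzero. Its value is constant on
the fiber, and its nonvanishing in `𝓞 L` survives every embedding, so it may be checked at one
embedding where `t` is huge compared with the `k j`. The sign in `±t` is needed because `fricke t 2
t = 0` while `fricke (-t) 2 t = 4 t²`. In the one-holed torus no sign is free, which is why `(1, 1,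
2)` is exceptional.

For the arithmetic, Kronecker's theorem makes a unit of infinite order large at some embedding. If
`w` is a high power of it, a root of `u² = w u + 1` is a unit with `u - u⁻¹ = w`, and `t² = w² + 4`
is large. Then `u` is not a root of unity, so `t` avoids `E` at every embedding. -/

/-! ### Homomorphisms out of surface groups -/

section SurfaceGroupHom

variable {g n : ℕ} {G : Type*} [Group G]

/-- The value of the surface relator on a tuple of group elements. -/
def surfaceProduct (F : SurfaceGen g n → G) : G :=
  (List.ofFn fun i : Fin g => F (.alpha i) * F (.beta i) * (F (.alpha i))⁻¹ * (F (.beta i))⁻¹).prod *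
    (List.ofFn fun j : Fin n => F (.gamma j)).prod

theorem lift_surfaceRelator (F : SurfaceGen g n → G) :
    FreeGroup.lift F (surfaceRelator g n) = surfaceProduct F := by
  simp [surfaceRelator, surfaceProduct, map_list_prod, List.map_ofFn, Function.comp_def]

namespace SurfaceGroup

/-- The homomorphism from a surface group determined by the images of the generators. -/
def hom (F : SurfaceGen g n → G) (h : surfaceProduct F = 1) : SurfaceGroup g n →* G :=
  PresentedGroup.toGroup (f := F) (by
    rintro r rfl
    rw [lift_surfaceRelator, h])

@[simp]
theorem hom_of (F : SurfaceGen g n → G) (h : surfaceProduct F = 1) (x : SurfaceGen g n) :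
    hom F h (PresentedGroup.of x) = F x :=
  PresentedGroup.toGroup.of _

@[simp]
theorem hom_punctureLoop (F : SurfaceGen g n → G) (h : surfaceProduct F = 1) (j : Fin n) :
    hom F h (punctureLoop j) = F (.gamma j) :=
  PresentedGroup.toGroup.of _

theorem surfaceProduct_eq_one (φ : SurfaceGroup g n →* G) :
    surfaceProduct (fun x => φ (PresentedGroup.of x)) = 1 := by
  rw [← lift_surfaceRelator]
  have : FreeGroup.lift (fun x => φ (PresentedGroup.of x)) =
      φ.comp (PresentedGroup.mk {surfaceRelator g n}) := by
    ext x
    simp [PresentedGroup.of]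
  rw [this, MonoidHom.comp_apply, PresentedGroup.one_of_mem (Set.mem_singleton _), map_one]

end SurfaceGroup

end SurfaceGroupHom

namespace PantsGluing

section Hom

variable {g n : ℕ} (Γ : PantsGluing g n) {G : Type*} [_root_.Group G]

/-- The generator that crosses the curve `e`. -/
def crossing (e : Γ.Curve) : Γ.Group := PresentedGroup.of (Gen.cross e)

theorem pants_relation (v : Γ.Pants) :
    Γ.boundaryLoop (v, 0) * Γ.boundaryLoop (v, 1) * Γ.boundaryLoop (v, 2) = 1 :=
  PresentedGroup.one_of_mem (rels := {r | Γ.Rel r}) (Rel.pants v)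

theorem glue_relation (e : Γ.Curve) :
    Γ.crossing e * Γ.boundaryLoop (Γ.side (e, false)) * (Γ.crossing e)⁻¹ *
      Γ.boundaryLoop (Γ.side (e, true)) = 1 :=
  PresentedGroup.one_of_mem (rels := {r | Γ.Rel r}) (Rel.glue e)

theorem tree_relation (e : Γ.Curve) (he : e ∈ Γ.tree) : Γ.crossing e = 1 :=
  PresentedGroup.one_of_mem (rels := {r | Γ.Rel r}) (Rel.tree e he)

variable {Γ}

/-- The homomorphism from the group of a glued surface determined by the images of the
generators. -/
def hom (c : Γ.Pants × Fin 3 → G) (x : Γ.Curve → G)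
    (hpants : ∀ v, c (v, 0) * c (v, 1) * c (v, 2) = 1)
    (hglue : ∀ e, x e * c (Γ.side (e, false)) * (x e)⁻¹ * c (Γ.side (e, true)) = 1)
    (htree : ∀ e ∈ Γ.tree, x e = 1) : Γ.Group →* G :=
  PresentedGroup.toGroup (f := fun y : Γ.Gen => Gen.casesOn y c x) (by
    rintro r (v | e | ⟨e, he⟩)
    · simpa using hpants v
    · simpa using hglue e
    · simpa using htree e he)

@[simp]
theorem hom_boundaryLoop (c : Γ.Pants × Fin 3 → G) (x : Γ.Curve → G) (h₁ h₂ h₃)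
    (h : Γ.Pants × Fin 3) : hom c x h₁ h₂ h₃ (Γ.boundaryLoop h) = c h :=
  PresentedGroup.toGroup.of _

@[simp]
theorem hom_crossing (c : Γ.Pants × Fin 3 → G) (x : Γ.Curve → G) (h₁ h₂ h₃)
    (e : Γ.Curve) : hom c x h₁ h₂ h₃ (Γ.crossing e) = x e :=
  PresentedGroup.toGroup.of _

theorem hom_ext {φ ψ : Γ.Group →* G}
    (h₁ : ∀ h, φ (Γ.boundaryLoop h) = ψ (Γ.boundaryLoop h))
    (h₂ : ∀ e, φ (Γ.crossing e) = ψ (Γ.crossing e)) : φ = ψ :=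
  PresentedGroup.ext fun x => by
    cases x with
    | bdry h => exact h₁ h
    | cross e => exact h₂ e

end Hom

/-! ### Three constructions of glued surfaces -/

/-- A single pair of pants. -/
def trinion : PantsGluing 0 3 where
  Pants := Unit
  Curve := Empty
  card_curve := by simp
  side x := x.1.elim
  leg j := ((), j)
  bijective := by
    constructor
    · rintro (⟨⟨⟩, _⟩ | i) (⟨⟨⟩, _⟩ | j) h
      simpa using h
    · rintro ⟨⟨⟩, j⟩
      exact ⟨Sum.inr j, rfl⟩
  tree := ∅
  tree_connected _ _ := Relation.ReflTransGen.refl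
  tree_card := by simp

variable {g n : ℕ}

/-- Counting boundary components twice; with this count, surjectivity alone gives bijectivity in the
two gluings below. -/
theorem card_sides (Γ : PantsGluing g n) :
    Fintype.card Γ.Curve * 2 + n = Fintype.card Γ.Pants * 3 := by
  simpa using Fintype.card_of_bijective Γ.bijective

/-- Glue a new pair of pants to the first puncture. -/
def addPants (Γ : PantsGluing g (n + 1)) : PantsGluing g (n + 2) where
  Pants := Option Γ.Pants
  Curve := Option Γ.Curve
  card_curve := by
    have := Γ.card_curve
    rw [Fintype.card_option]
    omega
  side
    | (some e, b) => (some (Γ.side (e, b)).1, (Γ.side (e, b)).2)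
    | (none, false) => (some (Γ.leg 0).1, (Γ.leg 0).2)
    -- With component `2` on the seam, the pants relation identifies the old puncture loop with the
    -- product of the new loops `0` and `1`.
    | (none, true) => (none, 2)
  leg := Fin.cons (none, 0) (Fin.cons (none, 1) fun j =>
    (some (Γ.leg j.succ).1, (Γ.leg j.succ).2))
  bijective := by
    rw [Fintype.bijective_iff_surjective_and_card]
    constructor
    · rintro ⟨_ | v, i⟩
      · fin_cases i
        · exact ⟨Sum.inr 0, rfl⟩
        · exact ⟨Sum.inr 1, rfl⟩
        · exact ⟨Sum.inl (none, true), rfl⟩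
      · obtain ⟨⟨e, b⟩ | j, h⟩ := Γ.bijective.2 (v, i)
        · exact ⟨Sum.inl (some e, b), congrArg (fun x => (some x.1, x.2)) h⟩
        · obtain rfl | ⟨j, rfl⟩ := Fin.eq_zero_or_eq_succ j
          · exact ⟨Sum.inl (none, false), congrArg (fun x => (some x.1, x.2)) h⟩
          · exact ⟨Sum.inr j.succ.succ, congrArg (fun x => (some x.1, x.2)) h⟩
    · have := Γ.card_sides
      simp only [Fintype.card_sum, Fintype.card_prod, Fintype.card_option, Fintype.card_fin,
        Fintype.card_bool]
      omega
  -- The new curve leads to the new vertex, so it joins the tree and its crossing is trivial.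
  tree := Finset.insertNone Γ.tree
  tree_connected := by
    set r : Option Γ.Pants → Option Γ.Pants → Prop := _
    change ∀ v w, Relation.ReflTransGen r v w
    have old : ∀ v w, Relation.ReflTransGen r (some v) (some w) := by
      intro v w
      refine (Γ.tree_connected v w).lift some ?_
      rintro v' w' ⟨e, he, b, h, h'⟩
      exact ⟨some e, by simpa using he, b, congrArg some h, congrArg some h'⟩
    have h₁ : r (some (Γ.leg 0).1) none := ⟨none, by simp, false, rfl, rfl⟩
    have h₂ : r none (some (Γ.leg 0).1) := ⟨none, by simp, true, rfl, rfl⟩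
    rintro (_ | v) (_ | w)
    · exact .refl
    · exact .head h₂ (old _ _)
    · exact .tail (old _ _) h₁
    · exact old _ _
  tree_card := by
    have := Γ.tree_card
    rw [Fintype.card_option, Finset.card_insertNone]
    omega

/-- Glue the first two punctures to each other. -/
def selfGlue (Γ : PantsGluing g (n + 2)) : PantsGluing (g + 1) n where
  Pants := Γ.Pants
  Curve := Option Γ.Curve
  card_curve := by
    have := Γ.card_curve
    rw [Fintype.card_option]
    omega
  side
    | (some e, b) => Γ.side (e, b)
    | (none, false) => Γ.leg 0
    | (none, true) => Γ.leg 1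
  leg j := Γ.leg j.succ.succ
  bijective := by
    rw [Fintype.bijective_iff_surjective_and_card]
    constructor
    · intro x
      obtain ⟨⟨e, b⟩ | j, h⟩ := Γ.bijective.2 x
      · exact ⟨Sum.inl (some e, b), h⟩
      · obtain rfl | ⟨j, rfl⟩ := Fin.eq_zero_or_eq_succ j
        · exact ⟨Sum.inl (none, false), h⟩
        · obtain rfl | ⟨j, rfl⟩ := Fin.eq_zero_or_eq_succ j
          · exact ⟨Sum.inl (none, true), h⟩
          · exact ⟨Sum.inr j, h⟩
    · have := Γ.card_sides
      simp only [Fintype.card_sum, Fintype.card_prod, Fintype.card_option, Fintype.card_fin,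
        Fintype.card_bool]
      omega
  -- No vertex is added, so the new curve stays outside the tree; its crossing becomes the new
  -- generator `β`.
  tree := Γ.tree.map Function.Embedding.some
  tree_connected := by
    intro v w
    refine (Γ.tree_connected v w).lift id ?_
    rintro v' w' ⟨e, he, b, h⟩
    exact ⟨some e, by simpa using he, b, h⟩
  tree_card := by simpa using Γ.tree_card

end PantsGluing

/-! ### Gluing on the level of surface groups -/

section Extension

variable {g n : ℕ} {G : Type*} [Group G]

namespace SurfaceGen

/-- Replace the first two puncture loops by their product. -/
def merge (F : SurfaceGen g (n + 2) → G) : SurfaceGen g (n + 1) → G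
  | alpha i => F (alpha i)
  | beta i => F (beta i)
  | gamma j => Fin.cons (α := fun _ => G) (F (gamma 0) * F (gamma 1))
      (fun j : Fin n => F (gamma j.succ.succ)) j

/-- Cut the last handle open, which turns it into two punctures. -/
def cut (F : SurfaceGen (g + 1) n → G) : SurfaceGen g (n + 2) → G
  | alpha i => F (alpha i.castSucc)
  | beta i => F (beta i.castSucc)
  | gamma j => Fin.cons (α := fun _ => G) (F (alpha (Fin.last g)))
      (Fin.cons (α := fun _ => G) (F (beta (Fin.last g)) * (F (alpha (Fin.last g)))⁻¹ *
        (F (beta (Fin.last g)))⁻¹) fun j : Fin n => F (gamma j)) j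

/-- Replace the first puncture loop by two loops `a` and `b`. -/
def split (F : SurfaceGen g (n + 1) → G) (a b : G) : SurfaceGen g (n + 2) → G
  | alpha i => F (alpha i)
  | beta i => F (beta i)
  | gamma j => Fin.cons (α := fun _ => G) a
      (Fin.cons (α := fun _ => G) b fun j : Fin n => F (gamma j.succ)) j

/-- Turn the first two punctures into a handle. -/
def sew (F : SurfaceGen g (n + 2) → G) (x : G) : SurfaceGen (g + 1) n → G
  | alpha i => Fin.snoc (α := fun _ => G) (fun i => F (alpha i)) (F (gamma 0)) i
  | beta i => Fin.snoc (α := fun _ => G) (fun i => F (beta i)) x i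
  | gamma j => F (gamma j.succ.succ)

theorem surfaceProduct_merge (F : SurfaceGen g (n + 2) → G) :
    surfaceProduct (merge F) = surfaceProduct F := by
  simp [surfaceProduct, merge, List.ofFn_succ, mul_assoc]

/-- The last commutator is `α · (β α⁻¹ β⁻¹)` and stands directly before the puncture loops, so it
can be read as two new puncture loops in front. This is why the last handle is matched with the
first two punctures. -/
theorem surfaceProduct_cut (F : SurfaceGen (g + 1) n → G) :
    surfaceProduct (cut F) = surfaceProduct F := by
  rw [surfaceProduct, surfaceProduct, List.ofFn_succ' (n := g)]
  simp [cut, List.ofFn_succ, mul_assoc]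

theorem merge_split (F : SurfaceGen g (n + 1) → G) (a b : G) (h : F (gamma 0) = a * b) :
    merge (split F a b) = F := by
  funext x
  cases x with
  | alpha i => rfl
  | beta i => rfl
  | gamma j =>
    refine Fin.cases ?_ (fun j => ?_) j
    · exact h.symm
    · rfl

theorem cut_sew (F : SurfaceGen g (n + 2) → G) (x : G)
    (h : F (gamma 1) = x * (F (gamma 0))⁻¹ * x⁻¹) : cut (sew F x) = F := by
  funext y
  cases y with
  | alpha i => simp [cut, sew]
  | beta i => simp [cut, sew]
  | gamma j =>
    refine Fin.cases ?_ (fun j => Fin.cases ?_ (fun j => ?_) j) j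
    · simp [cut, sew]
    · simpa [cut, sew] using h.symm
    · rfl

end SurfaceGen

open SurfaceGen

namespace SurfaceGroup

/-- The inclusion of `Σ_{g,n+1}` into the surface obtained by gluing a pair of pants to its first
puncture. -/
def inclPants : SurfaceGroup g (n + 1) →* SurfaceGroup g (n + 2) :=
  hom (merge PresentedGroup.of) (by
    rw [surfaceProduct_merge]
    exact surfaceProduct_eq_one (MonoidHom.id _))

/-- The map from the group of `Σ_{g,n+2}` to that of the surface obtained by gluing the first two
punctures to each other. -/
def inclHandle : SurfaceGroup g (n + 2) →* SurfaceGroup (g + 1) n :=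
  hom (cut PresentedGroup.of) (by
    rw [surfaceProduct_cut]
    exact surfaceProduct_eq_one (MonoidHom.id _))

/-- Extend a homomorphism over a pair of pants glued to the first puncture. -/
def extendPants (φ : SurfaceGroup g (n + 1) →* G) (a b : G) (h : φ (punctureLoop 0) = a * b) :
    SurfaceGroup g (n + 2) →* G :=
  hom (split (fun x => φ (PresentedGroup.of x)) a b) (by
    rw [← surfaceProduct_merge, merge_split _ _ _ h]
    exact surfaceProduct_eq_one φ)

/-- Extend a homomorphism over the handle obtained by gluing the first two punctures. -/
def extendHandle (φ : SurfaceGroup g (n + 2) →* G) (x : G)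
    (h : φ (punctureLoop 1) = x * (φ (punctureLoop 0))⁻¹ * x⁻¹) : SurfaceGroup (g + 1) n →* G :=
  hom (sew (fun y => φ (PresentedGroup.of y)) x) (by
    rw [← surfaceProduct_cut, cut_sew _ _ h]
    exact surfaceProduct_eq_one φ)

/-- Existence half of the universal property of the amalgam; `hom_ext_inclPants` is uniqueness. -/
theorem extendPants_comp_inclPants (φ : SurfaceGroup g (n + 1) →* G) (a b : G)
    (h : φ (punctureLoop 0) = a * b) : (extendPants φ a b h).comp inclPants = φ := by
  ext x
  cases x with
  | alpha i => simp [inclPants, extendPants, merge, split]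
  | beta i => simp [inclPants, extendPants, merge, split]
  | gamma j =>
    refine Fin.cases ?_ (fun j => ?_) j
    · simpa [inclPants, extendPants, merge, split, punctureLoop] using h.symm
    · simp [inclPants, extendPants, merge, split]

/-- Existence half of the universal property of the HNN extension with stable letter `β`;
`hom_ext_inclHandle` is uniqueness. -/
theorem extendHandle_comp_inclHandle (φ : SurfaceGroup g (n + 2) →* G) (x : G)
    (h : φ (punctureLoop 1) = x * (φ (punctureLoop 0))⁻¹ * x⁻¹) :
    (extendHandle φ x h).comp inclHandle = φ := by
  ext y
  cases y with
  | alpha i => simp [inclHandle, extendHandle, cut, sew]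
  | beta i => simp [inclHandle, extendHandle, cut, sew]
  | gamma j =>
    refine Fin.cases ?_ (fun j => Fin.cases ?_ (fun j => ?_) j) j
    · simp [inclHandle, extendHandle, cut, sew]
    · simpa [inclHandle, extendHandle, cut, sew, punctureLoop] using h.symm
    · simp [inclHandle, extendHandle, cut, sew]

@[simp]
theorem extendPants_punctureLoop_zero (φ : SurfaceGroup g (n + 1) →* G) (a b : G) (h) :
    extendPants φ a b h (punctureLoop 0) = a := by
  simp [extendPants, split]

@[simp]
theorem extendPants_punctureLoop_one (φ : SurfaceGroup g (n + 1) →* G) (a b : G) (h) :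
    extendPants φ a b h (punctureLoop 1) = b := by
  simp [extendPants, split]

@[simp]
theorem extendPants_punctureLoop_succ_succ (φ : SurfaceGroup g (n + 1) →* G) (a b : G) (h)
    (j : Fin n) : extendPants φ a b h (punctureLoop j.succ.succ) = φ (punctureLoop j.succ) := by
  simp [extendPants, split, punctureLoop]

@[simp]
theorem extendHandle_punctureLoop (φ : SurfaceGroup g (n + 2) →* G) (x : G) (h) (j : Fin n) :
    extendHandle φ x h (punctureLoop j) = φ (punctureLoop j.succ.succ) := by
  simp [extendHandle, sew, punctureLoop]

@[simp]
theorem inclPants_punctureLoop_zero : inclPants (punctureLoop (0 : Fin (n + 1))) =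
    punctureLoop 0 * (punctureLoop 1 : SurfaceGroup g (n + 2)) := by
  simp [inclPants, merge, punctureLoop]

@[simp]
theorem inclPants_punctureLoop_succ (j : Fin n) : inclPants (punctureLoop j.succ) =
    (punctureLoop j.succ.succ : SurfaceGroup g (n + 2)) := by
  simp [inclPants, merge, punctureLoop]

theorem inclHandle_punctureLoop_zero : inclHandle (punctureLoop (0 : Fin (n + 2))) =
    (PresentedGroup.of (alpha (Fin.last g)) : SurfaceGroup (g + 1) n) := by
  simp [inclHandle, cut, punctureLoop]

theorem inclHandle_punctureLoop_one : inclHandle (punctureLoop (1 : Fin (n + 2))) =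
    (PresentedGroup.of (beta (Fin.last g)) : SurfaceGroup (g + 1) n) *
      (PresentedGroup.of (alpha (Fin.last g)))⁻¹ * (PresentedGroup.of (beta (Fin.last g)))⁻¹ := by
  simp [inclHandle, cut, punctureLoop]

@[simp]
theorem inclHandle_punctureLoop_succ_succ (j : Fin n) : inclHandle (punctureLoop j.succ.succ) =
    (punctureLoop j : SurfaceGroup (g + 1) n) := by
  simp [inclHandle, cut, punctureLoop]

@[simp]
theorem extendHandle_beta_last (φ : SurfaceGroup g (n + 2) →* G) (x : G) (h) :
    extendHandle φ x h (PresentedGroup.of (beta (Fin.last g))) = x := by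
  simp [extendHandle, sew]

theorem hom_ext_inclPants {φ ψ : SurfaceGroup g (n + 2) →* G}
    (h : φ.comp inclPants = ψ.comp inclPants)
    (h₀ : φ (punctureLoop 0) = ψ (punctureLoop 0))
    (h₁ : φ (punctureLoop 1) = ψ (punctureLoop 1)) : φ = ψ := by
  ext x
  cases x with
  | alpha i => simpa [inclPants, merge] using DFunLike.congr_fun h (PresentedGroup.of (alpha i))
  | beta i => simpa [inclPants, merge] using DFunLike.congr_fun h (PresentedGroup.of (beta i))
  | gamma j =>
    refine Fin.cases h₀ (fun j => Fin.cases h₁ (fun j => ?_) j) j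
    change φ (punctureLoop _) = ψ (punctureLoop _)
    simpa using DFunLike.congr_fun h (punctureLoop j.succ)

theorem hom_ext_inclHandle {φ ψ : SurfaceGroup (g + 1) n →* G}
    (h : φ.comp inclHandle = ψ.comp inclHandle)
    (h' : φ (PresentedGroup.of (beta (Fin.last g))) = ψ (PresentedGroup.of (beta (Fin.last g)))) :
    φ = ψ := by
  ext x
  cases x with
  | alpha i =>
    refine Fin.lastCases ?_ (fun i => ?_) i
    · simpa [inclHandle_punctureLoop_zero] using DFunLike.congr_fun h (punctureLoop 0)
    · simpa [inclHandle, cut] using DFunLike.congr_fun h (PresentedGroup.of (alpha i))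
  | beta i =>
    refine Fin.lastCases h' (fun i => ?_) i
    simpa [inclHandle, cut] using DFunLike.congr_fun h (PresentedGroup.of (beta i))
  | gamma j =>
    change φ (punctureLoop _) = ψ (punctureLoop _)
    simpa using DFunLike.congr_fun h (punctureLoop j.succ.succ)

end SurfaceGroup

end Extension

namespace PantsGluing

variable {g n : ℕ} {Γ : PantsGluing g n} {G : Type*} [_root_.Group G] (φ : Γ.Group →* G)

theorem map_pants_relation (v : Γ.Pants) :
    φ (Γ.boundaryLoop (v, 0)) * φ (Γ.boundaryLoop (v, 1)) * φ (Γ.boundaryLoop (v, 2)) = 1 := by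
  rw [← map_mul, ← map_mul, Γ.pants_relation, map_one]

theorem map_glue_relation (e : Γ.Curve) :
    φ (Γ.crossing e) * φ (Γ.boundaryLoop (Γ.side (e, false))) * (φ (Γ.crossing e))⁻¹ *
      φ (Γ.boundaryLoop (Γ.side (e, true))) = 1 := by
  rw [← map_inv, ← map_mul, ← map_mul, ← map_mul, Γ.glue_relation, map_one]

theorem map_tree_relation (e : Γ.Curve) (he : e ∈ Γ.tree) : φ (Γ.crossing e) = 1 := by
  rw [Γ.tree_relation e he, map_one]

end PantsGluing

/-! ### Strict pants decompositions -/

namespace PantsDecomposition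

/-- The marking matches the loops around the punctures exactly, not only up to conjugation. -/
def IsStrict {g n : ℕ} (P : PantsDecomposition g n) : Prop :=
  ∀ j, P.marking (P.boundaryLoop (P.leg j)) = punctureLoop j

open PantsGluing SurfaceGroup

/-- The marking of a single pair of pants. -/
def trinionMarking : PantsGluing.trinion.Group ≃* SurfaceGroup 0 3 :=
  MonoidHom.toMulEquiv
    (PantsGluing.hom (fun h => punctureLoop h.2) (fun e => e.elim)
      (fun _ => by
        simpa [surfaceProduct, List.ofFn_succ, mul_assoc] using!
          surfaceProduct_eq_one (MonoidHom.id (SurfaceGroup 0 3)))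
      (fun e => e.elim) (fun e => e.elim))
    (SurfaceGroup.hom
      (fun | .alpha i => i.elim0 | .beta i => i.elim0
           | .gamma j => PantsGluing.trinion.boundaryLoop ((), j))
      (by
        simpa [surfaceProduct, List.ofFn_succ, mul_assoc] using
          PantsGluing.trinion.pants_relation ()))
    (PantsGluing.hom_ext
      (fun h => by
        rw [MonoidHom.comp_apply, hom_boundaryLoop, hom_punctureLoop]
        rfl)
      (fun e => e.elim))
    (by
      ext x
      cases x with
      | alpha i => exact i.elim0
      | beta i => exact i.elim0
      | gamma j => simp [punctureLoop])

/-- A pair of pants, with its tautological decomposition. -/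
def trinion : PantsDecomposition 0 3 where
  toPantsGluing := PantsGluing.trinion
  marking := trinionMarking
  marking_leg j := by
    rw [trinionMarking, MonoidHom.toMulEquiv_apply, PantsGluing.hom_boundaryLoop]
    rfl

theorem trinion_marking (h : trinion.Pants × Fin 3) :
    trinion.marking (trinion.boundaryLoop h) = punctureLoop h.2 := by
  change trinionMarking _ = _
  rw [trinionMarking, MonoidHom.toMulEquiv_apply]
  exact PantsGluing.hom_boundaryLoop ..

theorem trinion_isStrict : trinion.IsStrict := fun j => trinion_marking ((), j)

theorem IsStrict.symm_punctureLoop {g n : ℕ} {P : PantsDecomposition g n} (hP : P.IsStrict)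
    (j : Fin n) : P.marking.symm (punctureLoop j) = P.boundaryLoop (P.leg j) := by
  rw [← hP j, MulEquiv.symm_apply_apply]

/-! ### Pants decompositions under gluing on a pair of pants -/

section AddPants

variable {g n : ℕ} (P : PantsDecomposition g (n + 1))

/-- A boundary loop of the old surface after gluing on a pair of pants. -/
def addPantsOldLoop (h : P.Pants × Fin 3) : P.toPantsGluing.addPants.Group :=
  P.toPantsGluing.addPants.boundaryLoop (some h.1, h.2)

/-- A boundary loop of the new pair of pants. -/
def addPantsNewLoop (i : Fin 3) : P.toPantsGluing.addPants.Group :=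
  P.toPantsGluing.addPants.boundaryLoop (none, i)

/-- A crossing of the old surface after gluing on a pair of pants. -/
def addPantsOldCrossing (e : P.Curve) : P.toPantsGluing.addPants.Group :=
  P.toPantsGluing.addPants.crossing (some e)

/-- The crossing of the curve along which a new pair of pants is glued. -/
def addPantsNewCrossing : P.toPantsGluing.addPants.Group :=
  P.toPantsGluing.addPants.crossing none

theorem addPantsNewCrossing_eq_one : P.addPantsNewCrossing = 1 :=
  P.toPantsGluing.addPants.tree_relation none Finset.none_mem_insertNone

theorem addPantsNewLoop_relation :
    P.addPantsNewLoop 0 * P.addPantsNewLoop 1 * P.addPantsNewLoop 2 = 1 :=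
  P.toPantsGluing.addPants.pants_relation none

/-- The seam crossing is trivial, so the glue and pants relations both say that the third new loop
is the inverse of the respective side. This is the compatibility needed for the inverse marking. -/
theorem addPantsOldLoop_leg_zero :
    P.addPantsOldLoop (P.leg 0) = P.addPantsNewLoop 0 * P.addPantsNewLoop 1 := by
  have h : P.addPantsNewCrossing * P.addPantsOldLoop (P.leg 0) * P.addPantsNewCrossing⁻¹ *
      P.addPantsNewLoop 2 = 1 := P.toPantsGluing.addPants.glue_relation none
  rw [addPantsNewCrossing_eq_one, one_mul, inv_one, mul_one] at h
  exact mul_right_cancel (h.trans P.addPantsNewLoop_relation.symm)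

variable {P} in
theorem addPants_hom_ext {G : Type*} [_root_.Group G] {φ ψ : P.toPantsGluing.addPants.Group →* G}
    (hold : ∀ h, φ (P.addPantsOldLoop h) = ψ (P.addPantsOldLoop h))
    (hcross : ∀ e, φ (P.addPantsOldCrossing e) = ψ (P.addPantsOldCrossing e))
    (h₀ : φ (P.addPantsNewLoop 0) = ψ (P.addPantsNewLoop 0))
    (h₁ : φ (P.addPantsNewLoop 1) = ψ (P.addPantsNewLoop 1)) : φ = ψ := by
  refine PantsGluing.hom_ext ?_ ?_
  · rintro ⟨_ | v, i⟩
    · change φ (P.addPantsNewLoop i) = ψ (P.addPantsNewLoop i)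
      fin_cases i
      · exact h₀
      · exact h₁
      · have h : P.addPantsNewLoop 2 = (P.addPantsNewLoop 0 * P.addPantsNewLoop 1)⁻¹ :=
          eq_inv_of_mul_eq_one_right P.addPantsNewLoop_relation
        change φ (P.addPantsNewLoop 2) = ψ (P.addPantsNewLoop 2)
        rw [h, map_inv, map_inv, map_mul, map_mul, h₀, h₁]
    · exact hold (v, i)
  · rintro (_ | e)
    · change φ P.addPantsNewCrossing = ψ P.addPantsNewCrossing
      rw [addPantsNewCrossing_eq_one, map_one, map_one]
    · exact hcross e

/-- The map on fundamental groups induced by gluing on a pair of pants. -/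
def toAddPants : P.Group →* P.toPantsGluing.addPants.Group :=
  PantsGluing.hom P.addPantsOldLoop P.addPantsOldCrossing
    (fun v => P.toPantsGluing.addPants.pants_relation (some v))
    (fun e => P.toPantsGluing.addPants.glue_relation (some e))
    (fun e he => P.toPantsGluing.addPants.tree_relation (some e)
      (Finset.some_mem_insertNone.2 he))

@[simp]
theorem toAddPants_boundaryLoop (h : P.Pants × Fin 3) :
    P.toAddPants (P.boundaryLoop h) = P.addPantsOldLoop h :=
  PantsGluing.hom_boundaryLoop ..

@[simp]
theorem toAddPants_crossing (e : P.Curve) :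
    P.toAddPants (P.crossing e) = P.addPantsOldCrossing e :=
  PantsGluing.hom_crossing ..

variable {P} (hP : P.IsStrict)

/-- The marking of the surface with a pair of pants glued on. -/
def addPantsHom : P.toPantsGluing.addPants.Group →* SurfaceGroup g (n + 2) :=
  PantsGluing.hom
    (fun h => h.1.elim (![punctureLoop 0, punctureLoop 1, (punctureLoop 0 * punctureLoop 1)⁻¹] h.2)
      fun v => inclPants.comp P.marking.toMonoidHom (P.boundaryLoop (v, h.2)))
    (fun e => Option.elim e 1 fun e => inclPants.comp P.marking.toMonoidHom (P.crossing e))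
    (fun
      | some v => map_pants_relation (inclPants.comp P.marking.toMonoidHom) v
      | none => mul_inv_cancel _)
    (fun
      | some e => map_glue_relation (inclPants.comp P.marking.toMonoidHom) e
      | none => by
        change 1 * inclPants (P.marking (P.boundaryLoop (P.leg 0))) * 1⁻¹ *
          (punctureLoop 0 * punctureLoop 1)⁻¹ = 1
        simp [hP 0])
    (fun
      | some e => fun he => map_tree_relation (inclPants.comp P.marking.toMonoidHom) e
        (Finset.some_mem_insertNone.1 he)
      | none => fun _ => rfl)

@[simp]
theorem addPantsHom_oldLoop (h : P.Pants × Fin 3) :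
    addPantsHom hP (P.addPantsOldLoop h) = inclPants (P.marking (P.boundaryLoop h)) :=
  PantsGluing.hom_boundaryLoop ..

@[simp]
theorem addPantsHom_newLoop (i : Fin 3) : addPantsHom hP (P.addPantsNewLoop i) =
      ![punctureLoop 0, punctureLoop 1, (punctureLoop 0 * punctureLoop 1)⁻¹] i :=
  PantsGluing.hom_boundaryLoop ..

@[simp]
theorem addPantsHom_oldCrossing (e : P.Curve) :
    addPantsHom hP (P.addPantsOldCrossing e) = inclPants (P.marking (P.crossing e)) :=
  PantsGluing.hom_crossing ..

theorem addPantsHom_comp : (addPantsHom hP).comp P.toAddPants =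
    inclPants.comp P.marking.toMonoidHom :=
  PantsGluing.hom_ext (fun h => by simp) (fun e => by simp)

/-- The inverse of the marking of the surface with a pair of pants glued on. -/
def addPantsInv : SurfaceGroup g (n + 2) →* P.toPantsGluing.addPants.Group :=
  extendPants (P.toAddPants.comp P.marking.symm.toMonoidHom)
    (P.addPantsNewLoop 0) (P.addPantsNewLoop 1)
    (by simp [hP.symm_punctureLoop, addPantsOldLoop_leg_zero])

@[simp]
theorem addPantsInv_inclPants (x : SurfaceGroup g (n + 1)) :
    addPantsInv hP (inclPants x) = P.toAddPants (P.marking.symm x) := by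
  rw [addPantsInv, ← MonoidHom.comp_apply, extendPants_comp_inclPants]
  rfl

@[simp]
theorem addPantsInv_punctureLoop_zero :
    addPantsInv hP (punctureLoop 0) = P.addPantsNewLoop 0 := by
  simp [addPantsInv]

@[simp]
theorem addPantsInv_punctureLoop_one :
    addPantsInv hP (punctureLoop 1) = P.addPantsNewLoop 1 := by
  simp [addPantsInv]

/-- The marking of the surface with a pair of pants glued on, as an isomorphism. -/
def addPantsMarking : P.toPantsGluing.addPants.Group ≃* SurfaceGroup g (n + 2) :=
  MonoidHom.toMulEquiv (addPantsHom hP) (addPantsInv hP)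
    (addPants_hom_ext (fun h => by simp) (fun e => by simp) (by simp) (by simp))
    (hom_ext_inclPants
      (by
        rw [MonoidHom.id_comp]
        ext1 x
        have := DFunLike.congr_fun (addPantsHom_comp hP)
          (P.marking.symm (PresentedGroup.of x))
        simpa using this)
      (by simp) (by simp))

theorem addPantsMarking_leg (j : Fin (n + 2)) :
    addPantsMarking hP (P.toPantsGluing.addPants.boundaryLoop (P.toPantsGluing.addPants.leg j)) =
      punctureLoop j := by
  rw [addPantsMarking, MonoidHom.toMulEquiv_apply]
  refine Fin.cases ?_ (fun j => Fin.cases ?_ (fun j => ?_) j) j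
  · exact addPantsHom_newLoop hP 0
  · exact addPantsHom_newLoop hP 1
  · refine (addPantsHom_oldLoop hP (P.leg j.succ)).trans ?_
    rw [hP, inclPants_punctureLoop_succ]

/-- Glue a pair of pants to the first puncture of a surface with a pants decomposition. -/
def addPants : PantsDecomposition g (n + 2) where
  toPantsGluing := P.toPantsGluing.addPants
  marking := addPantsMarking hP
  marking_leg j := by
    rw [addPantsMarking_leg]

theorem addPants_isStrict : (addPants hP).IsStrict := addPantsMarking_leg hP

theorem addPants_marking_old (h : P.Pants × Fin 3) :
    (addPants hP).marking ((addPants hP).boundaryLoop ((some h.1 : Option P.Pants), h.2)) =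
      inclPants (P.marking (P.boundaryLoop h)) :=
  addPantsHom_oldLoop hP h

theorem addPants_marking_new (i : Fin 3) :
    (addPants hP).marking ((addPants hP).boundaryLoop ((none : Option P.Pants), i)) =
      ![punctureLoop 0, punctureLoop 1, (punctureLoop 0 * punctureLoop 1)⁻¹] i :=
  addPantsHom_newLoop hP i

theorem addPants_curve_some (e : P.Curve) :
    (addPants hP).curve (some e : Option P.Curve) = inclPants (P.curve e) :=
  addPantsHom_oldLoop hP _

theorem addPants_curve_none :
    (addPants hP).curve (none : Option P.Curve) = inclPants (punctureLoop 0) :=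
  (addPantsHom_oldLoop hP _).trans (congrArg _ (hP 0))

end AddPants

/-! ### Pants decompositions under sewing two punctures into a handle -/

section SelfGlue

variable {g n : ℕ} (P : PantsDecomposition g (n + 2))

/-- A boundary loop after gluing two punctures to each other. -/
def selfGlueLoop (h : P.Pants × Fin 3) : P.toPantsGluing.selfGlue.Group :=
  P.toPantsGluing.selfGlue.boundaryLoop h

/-- A crossing of the old surface after gluing two punctures to each other. -/
def selfGlueOldCrossing (e : P.Curve) : P.toPantsGluing.selfGlue.Group :=
  P.toPantsGluing.selfGlue.crossing (some e)

/-- The crossing of the curve along which two punctures are glued. -/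
def selfGlueNewCrossing : P.toPantsGluing.selfGlue.Group :=
  P.toPantsGluing.selfGlue.crossing none

theorem selfGlue_new_relation : P.selfGlueLoop (P.leg 1) =
    P.selfGlueNewCrossing * (P.selfGlueLoop (P.leg 0))⁻¹ * P.selfGlueNewCrossing⁻¹ := by
  have h : P.selfGlueNewCrossing * P.selfGlueLoop (P.leg 0) * P.selfGlueNewCrossing⁻¹ *
      P.selfGlueLoop (P.leg 1) = 1 := P.toPantsGluing.selfGlue.glue_relation none
  rw [eq_inv_of_mul_eq_one_right h]
  group

variable {P} in
theorem selfGlue_hom_ext {G : Type*} [_root_.Group G] {φ ψ : P.toPantsGluing.selfGlue.Group →* G}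
    (hloop : ∀ h, φ (P.selfGlueLoop h) = ψ (P.selfGlueLoop h))
    (hcross : ∀ e, φ (P.selfGlueOldCrossing e) = ψ (P.selfGlueOldCrossing e))
    (hnew : φ P.selfGlueNewCrossing = ψ P.selfGlueNewCrossing) : φ = ψ := by
  refine PantsGluing.hom_ext hloop ?_
  rintro (_ | e)
  · exact hnew
  · exact hcross e

/-- The map on fundamental groups induced by gluing two punctures. -/
def toSelfGlue : P.Group →* P.toPantsGluing.selfGlue.Group :=
  PantsGluing.hom P.selfGlueLoop P.selfGlueOldCrossing
    (fun v => P.toPantsGluing.selfGlue.pants_relation v)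
    (fun e => P.toPantsGluing.selfGlue.glue_relation (some e))
    (fun e he => P.toPantsGluing.selfGlue.tree_relation (some e)
      (Finset.mem_map_of_mem Function.Embedding.some he))

@[simp]
theorem toSelfGlue_boundaryLoop (h : P.Pants × Fin 3) :
    P.toSelfGlue (P.boundaryLoop h) = P.selfGlueLoop h :=
  PantsGluing.hom_boundaryLoop ..

@[simp]
theorem toSelfGlue_crossing (e : P.Curve) :
    P.toSelfGlue (P.crossing e) = P.selfGlueOldCrossing e :=
  PantsGluing.hom_crossing ..

variable {P} (hP : P.IsStrict)

/-- The marking of the surface with two punctures glued to each other. -/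
def selfGlueHom : P.toPantsGluing.selfGlue.Group →* SurfaceGroup (g + 1) n :=
  PantsGluing.hom
    (fun h => inclHandle.comp P.marking.toMonoidHom (P.boundaryLoop h))
    (fun e => Option.elim e (PresentedGroup.of (.beta (Fin.last g)))
      fun e => inclHandle.comp P.marking.toMonoidHom (P.crossing e))
    (map_pants_relation (inclHandle.comp P.marking.toMonoidHom))
    (fun
      | some e => map_glue_relation (inclHandle.comp P.marking.toMonoidHom) e
      | none => by
        change PresentedGroup.of (.beta (Fin.last g)) *
          inclHandle (P.marking (P.boundaryLoop (P.leg 0))) *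
          (PresentedGroup.of (.beta (Fin.last g)))⁻¹ *
          inclHandle (P.marking (P.boundaryLoop (P.leg 1))) = 1
        rw [hP 0, hP 1, inclHandle_punctureLoop_zero, inclHandle_punctureLoop_one]
        group)
    (fun e he => by
      obtain ⟨e, he', rfl⟩ := Finset.mem_map.1 he
      exact map_tree_relation (inclHandle.comp P.marking.toMonoidHom) e he')

@[simp]
theorem selfGlueHom_loop (h : P.Pants × Fin 3) :
    selfGlueHom hP (P.selfGlueLoop h) = inclHandle (P.marking (P.boundaryLoop h)) :=
  PantsGluing.hom_boundaryLoop ..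

@[simp]
theorem selfGlueHom_oldCrossing (e : P.Curve) :
    selfGlueHom hP (P.selfGlueOldCrossing e) = inclHandle (P.marking (P.crossing e)) :=
  PantsGluing.hom_crossing ..

@[simp]
theorem selfGlueHom_newCrossing :
    selfGlueHom hP P.selfGlueNewCrossing = PresentedGroup.of (.beta (Fin.last g)) :=
  PantsGluing.hom_crossing ..

theorem selfGlueHom_comp : (selfGlueHom hP).comp P.toSelfGlue =
    inclHandle.comp P.marking.toMonoidHom :=
  PantsGluing.hom_ext (fun h => by simp) (fun e => by simp)

/-- The inverse of the marking of the surface with two punctures glued to each other. -/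
def selfGlueInv : SurfaceGroup (g + 1) n →* P.toPantsGluing.selfGlue.Group :=
  extendHandle (P.toSelfGlue.comp P.marking.symm.toMonoidHom) P.selfGlueNewCrossing
    (by simpa [hP.symm_punctureLoop] using P.selfGlue_new_relation)

@[simp]
theorem selfGlueInv_inclHandle (x : SurfaceGroup g (n + 2)) :
    selfGlueInv hP (inclHandle x) = P.toSelfGlue (P.marking.symm x) := by
  rw [selfGlueInv, ← MonoidHom.comp_apply, extendHandle_comp_inclHandle]
  rfl

@[simp]
theorem selfGlueInv_beta_last :
    selfGlueInv hP (PresentedGroup.of (.beta (Fin.last g))) = P.selfGlueNewCrossing := by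
  simp [selfGlueInv]

/-- The marking of the surface with two punctures glued to each other, as an isomorphism. -/
def selfGlueMarking : P.toPantsGluing.selfGlue.Group ≃* SurfaceGroup (g + 1) n :=
  MonoidHom.toMulEquiv (selfGlueHom hP) (selfGlueInv hP)
    (selfGlue_hom_ext (fun h => by simp) (fun e => by simp) (by simp))
    (hom_ext_inclHandle
      (by
        rw [MonoidHom.id_comp]
        ext1 x
        have := DFunLike.congr_fun (selfGlueHom_comp hP)
          (P.marking.symm (PresentedGroup.of x))
        simpa using this)
      (by simp))

theorem selfGlueMarking_leg (j : Fin n) :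
    selfGlueMarking hP (P.toPantsGluing.selfGlue.boundaryLoop (P.toPantsGluing.selfGlue.leg j)) =
      punctureLoop j := by
  rw [selfGlueMarking, MonoidHom.toMulEquiv_apply]
  refine (selfGlueHom_loop hP (P.leg j.succ.succ)).trans ?_
  rw [hP, inclHandle_punctureLoop_succ_succ]

/-- Glue the first two punctures of a surface with a pants decomposition to each other. -/
def selfGlue : PantsDecomposition (g + 1) n where
  toPantsGluing := P.toPantsGluing.selfGlue
  marking := selfGlueMarking hP
  marking_leg j := by
    rw [selfGlueMarking_leg]

theorem selfGlue_isStrict : (selfGlue hP).IsStrict := selfGlueMarking_leg hP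

theorem selfGlue_marking (h : P.Pants × Fin 3) :
    (selfGlue hP).marking ((selfGlue hP).boundaryLoop h) =
      inclHandle (P.marking (P.boundaryLoop h)) :=
  selfGlueHom_loop hP h

theorem selfGlue_curve_some (e : P.Curve) :
    (selfGlue hP).curve (some e : Option P.Curve) = inclHandle (P.curve e) :=
  selfGlueHom_loop hP _

theorem selfGlue_curve_none :
    (selfGlue hP).curve (none : Option P.Curve) = inclHandle (punctureLoop 0) :=
  (selfGlueHom_loop hP _).trans (congrArg _ (hP 0))

end SelfGlue

end PantsDecomposition

/-! ### Regular elements of `SL₂` over a commutative ring -/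

namespace Matrix.SpecialLinearGroup

variable {R : Type*} [CommRing R]

/-- The trace of an element of `SL₂`. -/
abbrev tr (A : SL(2, R)) : R := (A : Matrix (Fin 2) (Fin 2) R).trace

theorem tr_conj (Q A : SL(2, R)) : tr (Q * A * Q⁻¹) = tr A := by
  rw [tr, coe_mul, Matrix.trace_mul_comm, ← coe_mul, ← mul_assoc, inv_mul_cancel, one_mul]

theorem tr_inv (A : SL(2, R)) : tr A⁻¹ = tr A := by
  rw [tr, tr, coe_inv, Matrix.adjugate_fin_two, Matrix.trace_fin_two, Matrix.trace_fin_two]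
  simp [add_comm]

theorem tr_eq_of_isConj {A B : SL(2, R)} (h : IsConj A B) : tr A = tr B := by
  obtain ⟨Q, rfl⟩ := isConj_iff.1 h
  rw [tr_conj]

/-- Some conjugate has an invertible upper right entry. -/
def IsRegular (A : SL(2, R)) : Prop := ∃ Q : SL(2, R), IsUnit ((Q * A * Q⁻¹) 0 1)

theorem isRegular_of_isUnit {A : SL(2, R)} (h : IsUnit (A 0 1)) : IsRegular A :=
  ⟨1, by simpa using h⟩

theorem IsRegular.conj {A : SL(2, R)} (h : IsRegular A) (P : SL(2, R)) :
    IsRegular (P * A * P⁻¹) := by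
  obtain ⟨Q, hQ⟩ := h
  refine ⟨Q * P⁻¹, ?_⟩
  convert hQ using 3
  group

theorem IsRegular.inv {A : SL(2, R)} (h : IsRegular A) : IsRegular A⁻¹ := by
  obtain ⟨Q, hQ⟩ := h
  refine ⟨Q, ?_⟩
  have : Q * A⁻¹ * Q⁻¹ = (Q * A * Q⁻¹)⁻¹ := by group
  rw [this, coe_inv, Matrix.adjugate_fin_two]
  simpa using hQ

/-- The element of `SL₂` with the given entries. -/
def ofEntries (a b c d : R) (h : a * d - b * c = 1) : SL(2, R) :=
  ⟨!![a, b; c, d], by rw [Matrix.det_fin_two_of, h]⟩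

theorem coe_ofEntries (a b c d : R) (h : a * d - b * c = 1) :
    (ofEntries a b c d h : Matrix (Fin 2) (Fin 2) R) = !![a, b; c, d] := rfl

/-- The diagonal matrix with entries `u` and `u⁻¹`. -/
def diagonal (u : Rˣ) : SL(2, R) := ofEntries u 0 0 (u⁻¹ : Rˣ) (by simp)

theorem coe_diagonal (u : Rˣ) :
    (diagonal u : Matrix (Fin 2) (Fin 2) R) = !![(u : R), 0; 0, (u⁻¹ : Rˣ)] := rfl

theorem tr_diagonal (u : Rˣ) : tr (diagonal u) = u + (u⁻¹ : Rˣ) := by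
  simp [tr, coe_diagonal, Matrix.trace_fin_two]

theorem isRegular_diagonal {u : Rˣ} (hu : IsUnit ((u : R) - (u⁻¹ : Rˣ))) :
    IsRegular (diagonal u) := by
  -- Conjugation by this unipotent matrix produces the upper right entry `u⁻¹ - u`.
  refine ⟨ofEntries 1 1 0 1 (by simp), ?_⟩
  have h := hu.neg
  rw [neg_sub] at h
  simpa [coe_diagonal, coe_inv, coe_ofEntries, Matrix.adjugate_fin_two, Matrix.mul_apply,
    Fin.sum_univ_two, sub_eq_neg_add, add_comm] using h

/-- After a conjugation making the upper right entry `b` a unit, with upper left entry `a`, the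
vectors `(b, u - a)` and `(b, u⁻¹ - a)` are eigenvectors. Their determinant `b (u⁻¹ - u)` is a unit,
so they form a basis over the ring. -/
theorem exists_conj_eq_diagonal {u : Rˣ} (hu : IsUnit ((u : R) - (u⁻¹ : Rˣ))) {A : SL(2, R)}
    (hA : IsRegular A) (htr : tr A = u + (u⁻¹ : Rˣ)) :
    ∃ Q : SL(2, R), A = Q * diagonal u * Q⁻¹ := by
  obtain ⟨Q, hQ⟩ := hA
  rw [← tr_conj Q] at htr
  suffices ∃ P : SL(2, R), Q * A * Q⁻¹ = P * diagonal u * P⁻¹ by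
    obtain ⟨P, hP⟩ := this
    refine ⟨Q⁻¹ * P, ?_⟩
    have : A = Q⁻¹ * (Q * A * Q⁻¹) * Q := by group
    rw [this, hP]
    group
  generalize Q * A * Q⁻¹ = M at hQ htr
  obtain ⟨s, hs⟩ := (hQ.mul hu).exists_left_inv
  have hdet := M.det_coe
  rw [Matrix.det_fin_two] at hdet
  rw [tr, Matrix.trace_fin_two] at htr
  have huu : (u : R) * (u⁻¹ : Rˣ) = 1 := u.mul_inv
  -- The columns are the two eigenvectors, the second scaled by `-s` to make the determinant `1`.
  refine ⟨ofEntries (M 0 1) (-(s * M 0 1)) (u - M 0 0) (-(s * ((u⁻¹ : Rˣ) - M 0 0)))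
    (by linear_combination hs), ?_⟩
  rw [eq_mul_inv_iff_mul_eq]
  ext i j
  rw [coe_mul, coe_mul, coe_diagonal, coe_ofEntries, Matrix.eta_fin_two (M : Matrix _ _ R)]
  generalize ((u⁻¹ : Rˣ) : R) = v at *
  fin_cases i <;> fin_cases j <;> simp only [Matrix.mul_apply, Fin.sum_univ_two] <;> simp
  · ring
  · ring
  · linear_combination u * htr - hdet + huu
  · linear_combination -s * (v * htr - hdet + huu)

/-- Two regular elements with the same split trace: one is conjugate to the inverse of the other. -/
theorem exists_eq_conj_inv {u : Rˣ} (hu : IsUnit ((u : R) - (u⁻¹ : Rˣ))) {A B : SL(2, R)}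
    (hA : IsRegular A) (hB : IsRegular B) (hAu : tr A = u + (u⁻¹ : Rˣ))
    (hBu : tr B = u + (u⁻¹ : Rˣ)) : ∃ Q : SL(2, R), B = Q * A⁻¹ * Q⁻¹ := by
  obtain ⟨P, hP⟩ := exists_conj_eq_diagonal hu hA.inv ((tr_inv A).trans hAu)
  obtain ⟨Q, hQ⟩ := exists_conj_eq_diagonal hu hB hBu
  refine ⟨Q * P⁻¹, ?_⟩
  rw [hP, hQ]
  group

/-- A regular element with split trace is a product of two regular elements with prescribed
traces. -/
theorem exists_eq_mul {u : Rˣ} (hu : IsUnit ((u : R) - (u⁻¹ : Rˣ))) {M : SL(2, R)}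
    (hM : IsRegular M) (htr : tr M = u + (u⁻¹ : Rˣ)) (y z : R) :
    ∃ A B : SL(2, R), M = A * B ∧ IsRegular A ∧ IsRegular B ∧ tr A = y ∧ tr B = z := by
  obtain ⟨Q, rfl⟩ := exists_conj_eq_diagonal hu hM htr
  obtain ⟨s, hs⟩ := hu.exists_left_inv
  suffices ∃ A B : SL(2, R), diagonal u = A * B ∧ IsRegular A ∧ IsRegular B ∧
      tr A = y ∧ tr B = z by
    obtain ⟨A, B, h, hA, hB, hy, hz⟩ := this
    refine ⟨Q * A * Q⁻¹, Q * B * Q⁻¹, ?_, hA.conj Q, hB.conj Q, ?_, ?_⟩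
    · rw [h]
      group
    · rw [tr_conj, hy]
    · rw [tr_conj, hz]
  -- For `A` with diagonal `a, y - a`, the trace of `A⁻¹ * diagonal u` is `y u - a (u - u⁻¹)`;
  -- setting it equal to `z` gives `a`. The upper right entries of the two factors are `1` and
  -- `-u⁻¹`, so both are regular.
  obtain ⟨a, ha⟩ : ∃ a, a = s * (y * u - z) := ⟨_, rfl⟩
  have hA : a * (y - a) - 1 * (a * (y - a) - 1) = 1 := by ring
  refine ⟨ofEntries a 1 (a * (y - a) - 1) (y - a) hA,
    (ofEntries a 1 (a * (y - a) - 1) (y - a) hA)⁻¹ * diagonal u, by group,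
    isRegular_of_isUnit (by simp [coe_ofEntries]), isRegular_of_isUnit ?_, ?_, ?_⟩
  · simp [coe_diagonal, coe_inv, coe_ofEntries, Matrix.adjugate_fin_two, Matrix.mul_apply,
      Fin.sum_univ_two]
  · simp [tr, coe_ofEntries, Matrix.trace_fin_two]
  · simp only [tr, coe_mul, coe_diagonal, coe_inv, coe_ofEntries, Matrix.adjugate_fin_two_of,
      Matrix.trace_fin_two, Matrix.mul_apply, Fin.sum_univ_two]
    simp
    linear_combination -(u - (u⁻¹ : Rˣ) : R) * ha - (y * u - z) * hs

end Matrix.SpecialLinearGroup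

/-! ### Realizing traces along a pants decomposition -/

open Matrix.SpecialLinearGroup SurfaceGroup

/-- The trace polynomial `x² + y² + z² - xyz - 4`, which vanishes on the traces of reducible
representations of the group of a pair of pants. -/
def fricke {R : Type*} [CommRing R] (x y z : R) : R :=
  x ^ 2 + y ^ 2 + z ^ 2 - x * y * z - 4

theorem map_fricke {R S : Type*} [CommRing R] [CommRing S] (f : R →+* S) (x y z : R) :
    f (fricke x y z) = fricke (f x) (f y) (f z) := by
  simp only [fricke, map_sub, map_add, map_mul, map_pow, map_ofNat]

namespace PantsDecomposition

variable {R : Type*} [CommRing R] {g n : ℕ}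

/-- The trace of `ρ` at a boundary component of a pair of pants. -/
def boundaryTrace (P : PantsDecomposition g n) (ρ : SurfaceGroup g n →* SL(2, R))
    (h : P.Pants × Fin 3) : R := tr (ρ (P.marking (P.boundaryLoop h)))

/-- The restriction of `ρ` to every pair of pants has nonzero trace polynomial. -/
def Nondegenerate (P : PantsDecomposition g n) (ρ : SurfaceGroup g n →* SL(2, R)) : Prop :=
  ∀ v, fricke (P.boundaryTrace ρ (v, 0)) (P.boundaryTrace ρ (v, 1)) (P.boundaryTrace ρ (v, 2)) ≠ 0

/-- `ρ` has regular values with traces `k` at the punctures of the strict decomposition `P`, and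
traces `±t` along its curves. -/
structure Realizes (P : PantsDecomposition g n) (t : R) (k : Fin n → R)
    (ρ : SurfaceGroup g n →* SL(2, R)) : Prop where
  isStrict : P.IsStrict
  trace_punctureLoop : ∀ j, tr (ρ (punctureLoop j)) = k j
  isRegular : ∀ j, (ρ (punctureLoop j)).IsRegular
  trace_curve : ∀ e, tr (ρ (P.curve e)) = t ∨ tr (ρ (P.curve e)) = -t

variable {t : R}

/-- `t = u + u⁻¹` for a unit `u` such that `u - u⁻¹` is a unit. -/
def IsSplitTrace (t : R) : Prop :=
  ∃ u : Rˣ, t = u + (u⁻¹ : Rˣ) ∧ IsUnit ((u : R) - (u⁻¹ : Rˣ))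

theorem IsSplitTrace.neg (ht : IsSplitTrace t) : IsSplitTrace (-t) := by
  obtain ⟨u, rfl, hu⟩ := ht
  refine ⟨-u, ?_, ?_⟩
  · rw [inv_neg, Units.val_neg, Units.val_neg, neg_add]
  · convert hu.neg using 1
    rw [inv_neg, Units.val_neg, Units.val_neg]
    ring

theorem IsSplitTrace.of_eq_or (ht : IsSplitTrace t) {s : R} (hs : s = t ∨ s = -t) :
    IsSplitTrace s := by
  obtain rfl | rfl := hs
  exacts [ht, ht.neg]

theorem exists_realizes_trinion (t : R) {s : R} (hs : IsSplitTrace s) (y z : R) :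
    ∃ ρ, trinion.Realizes t ![s, y, z] ρ ∧ (fricke s y z ≠ 0 → trinion.Nondegenerate ρ) := by
  obtain ⟨u, rfl, hu⟩ := hs
  obtain ⟨A, B, h, hA, hB, hy, hz⟩ :=
    exists_eq_mul hu (isRegular_diagonal hu) (tr_diagonal u) y z
  let F : SurfaceGen 0 3 → SL(2, R) :=
    -- Since `A * B = diagonal u`, the inverse in front makes the relator trivial without changing
    -- the prescribed trace.
    fun | .alpha i => i.elim0 | .beta i => i.elim0 | .gamma j => ![(diagonal u)⁻¹, A, B] j
  have hF : surfaceProduct F = 1 := by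
    simp [surfaceProduct, List.ofFn_succ, F, ← h]
  refine ⟨SurfaceGroup.hom F hF, ⟨trinion_isStrict, ?_, ?_, fun e => e.elim⟩, fun hk v => ?_⟩
  · intro j
    rw [hom_punctureLoop]
    fin_cases j
    · exact (tr_inv _).trans (tr_diagonal u)
    · exact hy
    · exact hz
  · intro j
    rw [hom_punctureLoop]
    fin_cases j
    · exact (isRegular_diagonal hu).inv
    · exact hA
    · exact hB
  · simp only [boundaryTrace, trinion_marking, hom_punctureLoop]
    change fricke (tr (diagonal u)⁻¹) (tr A) (tr B) ≠ 0
    rwa [tr_inv, tr_diagonal, hy, hz]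

theorem Realizes.exists_addPants {P : PantsDecomposition g (n + 1)} {k : Fin (n + 1) → R}
    {ρ : SurfaceGroup g (n + 1) →* SL(2, R)} (h : P.Realizes t k ρ) (ht : IsSplitTrace t)
    (hk : k 0 = t ∨ k 0 = -t) (y z : R) :
    ∃ ρ', (addPants h.isStrict).Realizes t
        (Fin.cons y (Fin.cons z fun j : Fin n => k j.succ)) ρ' ∧
      (P.Nondegenerate ρ → fricke y z (k 0) ≠ 0 → (addPants h.isStrict).Nondegenerate ρ') := by
  obtain ⟨u, hku, hu⟩ := ht.of_eq_or hk
  obtain ⟨A, B, hAB, hA, hB, hy, hz⟩ :=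
    exists_eq_mul hu (h.isRegular 0) ((h.trace_punctureLoop 0).trans hku) y z
  have hρ : ∀ x, extendPants ρ A B hAB (inclPants x) = ρ x :=
    DFunLike.congr_fun (extendPants_comp_inclPants ρ A B hAB)
  refine ⟨extendPants ρ A B hAB, ⟨addPants_isStrict _, ?_, ?_, ?_⟩, fun hN hf => ?_⟩
  · refine Fin.cases ?_ (Fin.cases ?_ fun j => ?_)
    · simpa using hy
    · simpa using hz
    · simpa using h.trace_punctureLoop j.succ
  · refine Fin.cases ?_ (Fin.cases ?_ fun j => ?_)
    · simpa using hA
    · simpa using hB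
    · simpa using h.isRegular j.succ
  · rintro (_ | e)
    · rw [addPants_curve_none, hρ, h.trace_punctureLoop]
      exact hk
    · rw [addPants_curve_some, hρ]
      exact h.trace_curve e
  · rintro (_ | v)
    · simp only [boundaryTrace]
      rw [addPants_marking_new, addPants_marking_new, addPants_marking_new]
      convert hf
      · simpa using hy
      · simpa using hz
      · change tr (extendPants ρ A B hAB (punctureLoop 0 * punctureLoop 1)⁻¹) = _
        rw [map_inv, tr_inv, map_mul, extendPants_punctureLoop_zero,
          extendPants_punctureLoop_one, ← hAB]
        exact h.trace_punctureLoop 0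
    · have key : ∀ i, (addPants h.isStrict).boundaryTrace (extendPants ρ A B hAB)
          ((some v : Option P.Pants), i) = P.boundaryTrace ρ (v, i) := fun i => by
        rw [boundaryTrace, addPants_marking_old h.isStrict (v, i), hρ, boundaryTrace]
      rw [key, key, key]
      exact hN v

theorem Realizes.exists_selfGlue {P : PantsDecomposition g (n + 2)} {k : Fin (n + 2) → R}
    {ρ : SurfaceGroup g (n + 2) →* SL(2, R)} (h : P.Realizes t k ρ) (ht : IsSplitTrace t)
    (hk₀ : k 0 = t) (hk₁ : k 1 = t) :
    ∃ ρ', (selfGlue h.isStrict).Realizes t (fun j => k j.succ.succ) ρ' ∧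
      (P.Nondegenerate ρ → (selfGlue h.isStrict).Nondegenerate ρ') := by
  obtain ⟨u, hku, hu⟩ := ht
  obtain ⟨T, hT⟩ := exists_eq_conj_inv hu (h.isRegular 0) (h.isRegular 1)
    (by rw [h.trace_punctureLoop, hk₀, hku]) (by rw [h.trace_punctureLoop, hk₁, hku])
  have hρ : ∀ x, extendHandle ρ T hT (inclHandle x) = ρ x :=
    DFunLike.congr_fun (extendHandle_comp_inclHandle ρ T hT)
  refine ⟨extendHandle ρ T hT, ⟨selfGlue_isStrict _, ?_, ?_, ?_⟩, fun hN v => ?_⟩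
  · intro j
    simpa using h.trace_punctureLoop j.succ.succ
  · intro j
    simpa using h.isRegular j.succ.succ
  · rintro (_ | e)
    · rw [selfGlue_curve_none, hρ, h.trace_punctureLoop]
      exact Or.inl hk₀
    · rw [selfGlue_curve_some, hρ]
      exact h.trace_curve e
  · have key : ∀ i, (selfGlue h.isStrict).boundaryTrace (extendHandle ρ T hT) (v, i) =
        P.boundaryTrace ρ (v, i) := fun i =>
      congrArg tr ((congrArg _ (selfGlue_marking h.isStrict (v, i))).trans (hρ _))
    rw [key, key, key]
    exact hN v

end PantsDecomposition

/-! ### Generic traces and induction over gluings -/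

theorem fricke_rotate {R : Type*} [CommRing R] (x y z : R) : fricke x y z = fricke y z x := by
  unfold fricke
  ring

theorem fricke_swap {R : Type*} [CommRing R] (x y z : R) : fricke x y z = fricke x z y := by
  unfold fricke
  ring

/-- The traces `±t` can be combined with traces in `F` to nondegenerate pairs of pants. -/
structure IsGenericTrace {R : Type*} [CommRing R] (t : R) (F : Set R) : Prop where
  one : ∀ s, s = t ∨ s = -t → ∀ x ∈ F, ∀ y ∈ F, fricke s x y ≠ 0
  two : ∀ s, s = t ∨ s = -t → ∀ x ∈ F, ∃ s', (s' = t ∨ s' = -t) ∧ fricke s' x s ≠ 0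
  loop : ∀ x ∈ F, x ≠ 2 → fricke t t x ≠ 0
  three : ∀ s, s = t ∨ s = -t → ∀ s', s' = t ∨ s' = -t → ∀ s'', s'' = t ∨ s'' = -t →
    fricke s s' s'' ≠ 0

namespace PantsDecomposition

variable {R : Type*} [CommRing R] {g n : ℕ} {t : R} {F : Set R}

/-- Some strict pants decomposition of `Σ_{g,n}` and some nondegenerate representation realize the
traces `k` at the punctures, with traces `±t` along the curves. -/
def Realizable (t : R) (g n : ℕ) (k : Fin n → R) : Prop :=
  ∃ (P : PantsDecomposition g n) (ρ : SurfaceGroup g n →* SL(2, R)),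
    P.Realizes t k ρ ∧ P.Nondegenerate ρ

theorem Realizable.addPants {k : Fin n → R} {s : R} (ht : IsSplitTrace t) (hs : s = t ∨ s = -t)
    (h : Realizable t g (n + 1) (Fin.cons s k)) {y z : R} (hf : fricke y z s ≠ 0) :
    Realizable t g (n + 2) (Fin.cons y (Fin.cons z k)) := by
  obtain ⟨P, ρ, hρ, hN⟩ := h
  obtain ⟨ρ', hρ', hN'⟩ := hρ.exists_addPants ht hs y z
  exact ⟨_, ρ', hρ', hN' hN hf⟩

theorem Realizable.selfGlue {k : Fin n → R} (ht : IsSplitTrace t)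
    (h : Realizable t g (n + 2) (Fin.cons t (Fin.cons t k))) :
    Realizable t (g + 1) n k := by
  obtain ⟨P, ρ, hρ, hN⟩ := h
  obtain ⟨ρ', hρ', hN'⟩ := hρ.exists_selfGlue ht rfl rfl
  exact ⟨_, ρ', hρ', hN' hN⟩

theorem _root_.IsGenericTrace.exists_sign (hF : IsGenericTrace t F) {x y : R}
    (hx : x ∈ F ∨ x = t ∨ x = -t) (hy : y ∈ F ∨ y = t ∨ y = -t) :
    ∃ s, (s = t ∨ s = -t) ∧ fricke s x y ≠ 0 := by
  rcases hx with hx | hx <;> rcases hy with hy | hy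
  · exact ⟨t, .inl rfl, hF.one t (.inl rfl) x hx y hy⟩
  · exact hF.two y hy x hx
  · obtain ⟨s, hs, h⟩ := hF.two x hx y hy
    exact ⟨s, hs, by rwa [fricke_swap]⟩
  · exact ⟨t, .inl rfl, hF.three t (.inl rfl) x hx y hy⟩

/-- The sign of the leading puncture trace is left free: that puncture becomes the next seam, and
its sign is chosen so that the pair of pants carrying it is nondegenerate. -/
theorem exists_realizable_sphere_cons (ht : IsSplitTrace t) (hF : IsGenericTrace t F) (n : ℕ)
    (k : Fin (n + 2) → R) (hk : ∀ j, k j ∈ F ∨ k j = t ∨ k j = -t) :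
    ∃ s, (s = t ∨ s = -t) ∧ Realizable t 0 (n + 3) (Fin.cons s k) := by
  induction n with
  | zero =>
    obtain ⟨s, hs, hf⟩ := hF.exists_sign (hk 0) (hk 1)
    obtain ⟨ρ, hρ, hN⟩ := exists_realizes_trinion t (ht.of_eq_or hs) (k 0) (k 1)
    refine ⟨s, hs, trinion, ρ, ?_, hN hf⟩
    convert hρ using 1
    funext j
    fin_cases j <;> rfl
  | succ n ih =>
    obtain ⟨s, hs, hr⟩ := ih (fun j => k j.succ) (fun j => hk j.succ)
    obtain ⟨s', hs', hf⟩ := hF.exists_sign (hk 0) (Or.inr hs)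
    refine ⟨s', hs', ?_⟩
    have := hr.addPants ht hs hf
    rwa [show (Fin.cons (k 0) fun j => k j.succ : Fin (n + 3) → R) = k from
      Fin.cons_self_tail k] at this

/-- The last pair of pants has both outer traces prescribed and an uncontrolled seam sign, hence the
hypothesis for both signs. -/
theorem realizable_sphere (ht : IsSplitTrace t) (hF : IsGenericTrace t F) {m : ℕ} {y z : R}
    {k : Fin m → R} (hm : 2 ≤ m) (hk : ∀ j, k j ∈ F ∨ k j = t ∨ k j = -t)
    (hyz : ∀ s, s = t ∨ s = -t → fricke y z s ≠ 0) :
    Realizable t 0 (m + 2) (Fin.cons y (Fin.cons z k)) := by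
  obtain ⟨m, rfl⟩ := Nat.exists_eq_add_of_le' hm
  obtain ⟨s, hs, hr⟩ := exists_realizable_sphere_cons ht hF m k hk
  exact hr.addPants ht hs (hyz s hs)

/-- The tuple `k` preceded by `2 * g` entries `t`. -/
def padTraces (t : R) (k : Fin n → R) : (g : ℕ) → Fin (n + 2 * g) → R
  | 0 => k
  | g + 1 => Fin.cons t (Fin.cons t (padTraces t k g))

theorem padTraces_mem {k : Fin n → R} (hk : ∀ j, k j ∈ F) (g : ℕ) (j : Fin (n + 2 * g)) :
    padTraces t k g j ∈ F ∨ padTraces t k g j = t ∨ padTraces t k g j = -t := by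
  induction g with
  | zero => exact .inl (hk j)
  | succ g ih =>
    refine Fin.cases (.inr (.inl rfl)) (Fin.cases (.inr (.inl rfl)) fun j => ?_) j
    exact ih j

theorem Realizable.of_padTraces (ht : IsSplitTrace t) {k : Fin n → R} {h g G : ℕ}
    (hG : h + g = G) (hr : Realizable t h (n + 2 * g) (padTraces t k g)) :
    Realizable t G n k := by
  induction g generalizing h with
  | zero =>
    subst hG
    exact hr
  | succ g ih => exact ih (by omega) (hr.selfGlue ht)

theorem realizable (ht : IsSplitTrace t) (hF : IsGenericTrace t F) (hgn : 3 < 2 * g + n)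
    {k : Fin n → R} (hk : ∀ j, k j ∈ F) : Realizable t g n k := by
  rcases g with _ | g
  · obtain ⟨m, rfl⟩ : ∃ m, n = m + 4 := ⟨n - 4, by omega⟩
    -- In genus zero the last pair of pants carries two traces from `F`, which are harmless with
    -- either seam sign.
    have := realizable_sphere ht hF (y := k 0) (z := k 1) (k := fun j : Fin (m + 2) => k j.succ.succ)
      (by omega) (fun j => .inl (hk _)) (fun s hs => by
        rw [← fricke_rotate]
        exact hF.one s hs _ (hk 0) _ (hk 1))
    rwa [show (Fin.cons (k 1) fun j => k j.succ.succ : Fin (m + 3) → R) = fun j => k j.succ from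
      Fin.cons_self_tail (fun j => k j.succ),
      show (Fin.cons (k 0) fun j => k j.succ : Fin (m + 4) → R) = k from
      Fin.cons_self_tail k] at this
  · refine Realizable.of_padTraces ht (zero_add (g + 1)) ?_
    -- In genus `g + 1` the last pair of pants carries two of the padding traces `t`, harmless by
    -- `three`. All padding traces are exactly `t`, as sewing requires.
    exact realizable_sphere ht hF (m := n + 2 * g) (by omega) (padTraces_mem hk g)
      (hF.three t (.inl rfl) t (.inl rfl))

theorem exists_realizes_torus (ht : IsSplitTrace t) (k : Fin 1 → R) :
    ∃ (P : PantsDecomposition 1 1) (ρ : SurfaceGroup 1 1 →* SL(2, R)),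
      P.Realizes t k ρ ∧ (fricke t t (k 0) ≠ 0 → P.Nondegenerate ρ) := by
  obtain ⟨ρ, hρ, hN⟩ := exists_realizes_trinion t ht t (k 0)
  obtain ⟨ρ', hρ', hN'⟩ := hρ.exists_selfGlue ht rfl rfl
  refine ⟨selfGlue hρ.isStrict, ρ', ?_, fun hf => hN' (hN hf)⟩
  convert hρ' using 1
  funext j
  fin_cases j
  rfl

end PantsDecomposition

/-! ### Irreducibility on pairs of pants -/

/-- Both sides are `tr [A, B] - 2`, by Fricke's trace identity and by `det (AB - BA) = det ([A, B] -
1)`. -/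
theorem fricke_eq_neg_det {R : Type*} [CommRing R] (A B : SL(2, R)) :
    fricke (tr A) (tr B) (tr (A * B)) =
      -((A : Matrix (Fin 2) (Fin 2) R) * B - B * A : Matrix (Fin 2) (Fin 2) R).det := by
  have hA := A.det_coe
  have hB := B.det_coe
  rw [Matrix.det_fin_two] at hA hB
  simp only [fricke, tr, coe_mul, Matrix.trace_fin_two, Matrix.det_fin_two, Matrix.mul_apply,
    Fin.sum_univ_two, Matrix.sub_apply]
  linear_combination (4 * (A 0 0 * A 1 1 - A 0 1 * A 1 0) - (A 0 0 + A 1 1) ^ 2) * hB +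
    (4 - (B 0 0 + B 1 1) ^ 2) * hA

/-- A common eigenvector is killed by `AB - BA`, so that commutator is singular. -/
theorem fricke_eq_zero_of_common_eigenvector {F : Type*} [Field F] {A B : SL(2, F)}
    {x : Fin 2 → F} (hx : x ≠ 0) {a b : F}
    (hA : (A : Matrix (Fin 2) (Fin 2) F).mulVec x = a • x)
    (hB : (B : Matrix (Fin 2) (Fin 2) F).mulVec x = b • x) :
    fricke (tr A) (tr B) (tr (A * B)) = 0 := by
  rw [fricke_eq_neg_det, neg_eq_zero, ← Matrix.exists_mulVec_eq_zero_iff]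
  refine ⟨x, hx, ?_⟩
  rw [Matrix.sub_mulVec, ← Matrix.mulVec_mulVec, ← Matrix.mulVec_mulVec, hA, hB,
    Matrix.mulVec_smul, Matrix.mulVec_smul, hA, hB, smul_comm, sub_self]

/-- A proper nonzero invariant subspace of `ℂ²` is a line, which gives a common eigenvector. -/
theorem isIrreducible_stdRep_comp {H : Type*} [Group H] (φ : H →* SL(2, ℂ)) (a b : H)
    (h : fricke (tr (φ a)) (tr (φ b)) (tr (φ a * φ b)) ≠ 0) :
    Representation.IsIrreducible (stdRep.comp φ) where
  exists_pair_ne := ⟨⊥, ⊤, fun h => by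
    have := congrArg (Subrepresentation.toSubmodule) h
    exact bot_ne_top this⟩
  eq_bot_or_eq_top W := by
    by_contra! hW
    obtain ⟨h₀, h₁⟩ := hW
    have h₀' : W.toSubmodule ≠ ⊥ := fun h => h₀ (Subrepresentation.toSubmodule_injective h)
    have h₁' : W.toSubmodule ≠ ⊤ := fun h => h₁ (Subrepresentation.toSubmodule_injective h)
    have hpos : 0 < Module.finrank ℂ W.toSubmodule := by
      rwa [Nat.pos_iff_ne_zero, Ne, Submodule.finrank_eq_zero]
    have hlt : Module.finrank ℂ W.toSubmodule < 2 := by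
      simpa using Submodule.finrank_lt h₁'
    obtain ⟨x, hx, hspan⟩ := finrank_eq_one_iff'.1
      (show Module.finrank ℂ W.toSubmodule = 1 by omega)
    have key : ∀ c : H, ∃ l : ℂ, (φ c : Matrix (Fin 2) (Fin 2) ℂ).mulVec (x : Fin 2 → ℂ) =
        l • (x : Fin 2 → ℂ) := by
      intro c
      obtain ⟨l, hl⟩ := hspan ⟨_, W.apply_mem_toSubmodule c x.2⟩
      exact ⟨l, (congrArg Subtype.val hl).symm⟩
    obtain ⟨l, hl⟩ := key a
    obtain ⟨m, hm⟩ := key b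
    exact h (fricke_eq_zero_of_common_eigenvector (by simpa using hx) hl hm)

/-! ### From traces to goodness -/

namespace PantsDecomposition

variable {g n : ℕ} {P : PantsDecomposition g n}

theorem boundaryTrace_side {R : Type*} [CommRing R] (ρ : SurfaceGroup g n →* SL(2, R))
    (e : P.Curve) (b : Bool) : P.boundaryTrace ρ (P.side (e, b)) = tr (ρ (P.curve e)) := by
  cases b with
  | false => rfl
  | true =>
    have h := PantsGluing.map_glue_relation (ρ.comp P.marking.toMonoidHom) e
    have h' : ρ (P.marking (P.boundaryLoop (P.side (e, true)))) =
      (ρ (P.marking (P.crossing e)) * ρ (P.curve e) * (ρ (P.marking (P.crossing e)))⁻¹)⁻¹ :=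
      eq_inv_of_mul_eq_one_right h
    rw [boundaryTrace, h', tr_inv, tr_conj]

theorem boundaryTrace_leg {R : Type*} [CommRing R] (ρ : SurfaceGroup g n →* SL(2, R))
    (j : Fin n) : P.boundaryTrace ρ (P.leg j) = tr (ρ (punctureLoop j)) :=
  tr_eq_of_isConj (ρ.map_isConj (P.marking_leg j))

/-- Every boundary component is a side of a curve or a puncture, so the fiber fixes all boundary
traces. Nondegeneracy of one point thus passes to the whole fiber. -/
theorem boundaryTrace_eq_of_inFiber {ρ ρ' : SurfaceGroup g n →* SL(2, ℂ)}
    (h : P.InFiber (fun j => tr (ρ (punctureLoop j))) (fun e => tr (ρ (P.curve e))) ρ')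
    (x : P.Pants × Fin 3) : P.boundaryTrace ρ' x = P.boundaryTrace ρ x := by
  obtain ⟨⟨e, b⟩ | j, rfl⟩ := P.bijective.2 x
  · exact (boundaryTrace_side ρ' e b).trans ((h.2 e).trans (boundaryTrace_side ρ e b).symm)
  · exact (boundaryTrace_leg ρ' j).trans ((h.1 j).trans (boundaryTrace_leg ρ j).symm)

theorem irreducibleOn_of_fricke_ne_zero {ρ : SurfaceGroup g n →* SL(2, ℂ)} {v : P.Pants}
    (h : fricke (P.boundaryTrace ρ (v, 0)) (P.boundaryTrace ρ (v, 1))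
      (P.boundaryTrace ρ (v, 2)) ≠ 0) : P.IrreducibleOn ρ v := by
  have hc : ∀ i, P.marking (P.boundaryLoop (v, i)) ∈ P.pantsSubgroup v := fun i =>
    Subgroup.subset_closure ⟨i, rfl⟩
  refine isIrreducible_stdRep_comp _ ⟨_, hc 0⟩ ⟨_, hc 1⟩ ?_
  have h₂ : P.boundaryTrace ρ (v, 2) =
      tr (ρ (P.marking (P.boundaryLoop (v, 0))) * ρ (P.marking (P.boundaryLoop (v, 1)))) := by
    have h₃ : ρ (P.marking (P.boundaryLoop (v, 2))) = (ρ (P.marking (P.boundaryLoop (v, 0))) *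
        ρ (P.marking (P.boundaryLoop (v, 1))))⁻¹ := eq_inv_of_mul_eq_one_right
      (PantsGluing.map_pants_relation (ρ.comp P.marking.toMonoidHom) v)
    rw [boundaryTrace, h₃, tr_inv]
  rw [h₂] at h
  exact h

theorem neg_notMem_rootOfUnityTraces {z : ℂ} (hz : z ∉ rootOfUnityTraces) :
    -z ∉ rootOfUnityTraces := by
  rintro ⟨ζ, ⟨m, hm, h⟩, hζ⟩
  refine hz ⟨-ζ, ⟨2 * m, by omega, ?_⟩, ?_⟩
  · rw [pow_mul, neg_sq, ← pow_mul, mul_comm, pow_mul, h, one_pow]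
  · rw [inv_neg, ← neg_add, ← hζ, neg_neg]

theorem Realizes.isGood_map {R : Type*} [CommRing R] {t : R} {k : Fin n → R}
    {ρ : SurfaceGroup g n →* SL(2, R)} (h : P.Realizes t k ρ) {f : R →+* ℂ}
    (hf : Function.Injective f) (ht : f t ∉ rootOfUnityTraces)
    (hN : P.Nondegenerate ρ ∨ (g = 1 ∧ n = 1 ∧ ∀ j, k j = 2)) :
    P.IsGood ((Matrix.SpecialLinearGroup.map f).comp ρ) := by
  have htr : ∀ x, tr ((Matrix.SpecialLinearGroup.map f).comp ρ x) = f (tr (ρ x)) := fun x => by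
    simp [tr, Matrix.trace_fin_two]
  have hcurve : ∀ e, tr ((Matrix.SpecialLinearGroup.map f).comp ρ (P.curve e)) ∉
      rootOfUnityTraces := fun e => by
    rw [htr]
    obtain h | h := h.trace_curve e
    · rwa [h]
    · rw [h, map_neg]
      exact neg_notMem_rootOfUnityTraces ht
  refine ⟨hcurve, fun ρ' hρ' e => ?_, hN.imp (fun hN ρ' hρ' v => ?_) ?_⟩
  · constructor
    · intro h2
      -- The values `±2` are `ζ + ζ⁻¹` for `ζ = ±1`, so avoiding `E` already excludes them.
      exact hcurve e ⟨1, ⟨1, one_pos, one_pow _⟩, (hρ'.2 e).symm.trans (h2.trans (by norm_num))⟩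
    · intro h2
      exact hcurve e ⟨-1, ⟨2, two_pos, by norm_num⟩, (hρ'.2 e).symm.trans (h2.trans (by norm_num))⟩
  · refine irreducibleOn_of_fricke_ne_zero ?_
    simp only [boundaryTrace_eq_of_inFiber hρ']
    have := (map_ne_zero_iff f hf).2 (hN v)
    simp only [boundaryTrace, htr]
    simpa only [map_fricke, boundaryTrace] using this
  · rintro ⟨hg, hn, hk⟩
    refine ⟨hg, hn, fun j => (htr _).trans ?_⟩
    rw [h.trace_punctureLoop, hk, map_ofNat]

end PantsDecomposition

/-! ### Large split traces are generic -/

/-- A zero would force `‖s‖² ≤ ‖s‖ C² + 2 C² + 4`, impossible beyond the stated threshold. -/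
theorem fricke_ne_zero_of_norm_lt {C : ℝ} (hC : 1 ≤ C) {s x y : ℂ} (hx : ‖x‖ ≤ C) (hy : ‖y‖ ≤ C)
    (hs : 3 * C ^ 2 + 5 < ‖s‖) : fricke s x y ≠ 0 := by
  intro h
  have h' : s ^ 2 = s * (x * y) - x ^ 2 - y ^ 2 + 4 := by
    unfold fricke at h
    linear_combination h
  have h₁ : ‖s‖ ^ 2 ≤ ‖s‖ * (‖x‖ * ‖y‖) + ‖x‖ ^ 2 + ‖y‖ ^ 2 + 4 := by
    calc ‖s‖ ^ 2 = ‖s * (x * y) - x ^ 2 - y ^ 2 + 4‖ := by rw [← norm_pow, h']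
      _ ≤ ‖s * (x * y)‖ + ‖x ^ 2‖ + ‖y ^ 2‖ + ‖(4 : ℂ)‖ :=
        (norm_add_le _ _).trans (by
          gcongr
          exact (norm_sub_le _ _).trans (by gcongr; exact norm_sub_le _ _))
      _ = _ := by simp
  have hxy : ‖x‖ * ‖y‖ ≤ C * C := by gcongr
  have hx2 : ‖x‖ ^ 2 ≤ C ^ 2 := by gcongr
  have hy2 : ‖y‖ ^ 2 ≤ C ^ 2 := by gcongr
  have h₂ : ‖s‖ * (‖x‖ * ‖y‖) ≤ ‖s‖ * (C * C) := by gcongr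
  nlinarith [norm_nonneg s]

theorem isGenericTrace_of_norm_lt {R : Type*} [CommRing R] {t : R} {F : Set R} (f : R →+* ℂ)
    (hf : Function.Injective f) {C : ℝ} (hC : 1 ≤ C) (hF : ∀ x ∈ F, ‖f x‖ ≤ C)
    (ht : 3 * C ^ 2 + 5 < ‖f t‖) : IsGenericTrace t F := by
  have hs : ∀ s, s = t ∨ s = -t → 3 * C ^ 2 + 5 < ‖f s‖ := by
    rintro s (rfl | rfl)
    · exact ht
    · rwa [map_neg, norm_neg]
  have hmap : ∀ x y z : R, fricke (f x) (f y) (f z) ≠ 0 → fricke x y z ≠ 0 := fun x y z h => by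
    rwa [← map_fricke, map_ne_zero_iff f hf] at h
  have hloop : ∀ s, s = t ∨ s = -t → ∀ x ∈ F, x ≠ 2 → fricke s x s ≠ 0 := by
    intro s h x hx h2
    refine hmap _ _ _ ?_
    rw [show fricke (f s) (f x) (f s) = (2 - f x) * (f s ^ 2 - (2 + f x)) by unfold fricke; ring]
    refine mul_ne_zero (sub_ne_zero.2 fun h => h2 (hf ?_)) (sub_ne_zero.2 fun h' => ?_)
    · rw [← h, map_ofNat]
    · have h₁ : ‖f s‖ ^ 2 ≤ 2 + ‖f x‖ := by
        rw [← norm_pow, h']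
        exact (norm_add_le _ _).trans (by simp)
      nlinarith [hs s h, hF x hx]
  have hpos : ∀ s, s = t ∨ s = -t → f s ≠ 0 := fun s h => norm_pos_iff.1 (by nlinarith [hs s h])
  refine ⟨fun s h x hx y hy => hmap _ _ _ ?_, fun s h x hx => ?_, fun x hx h2 => ?_, ?_⟩
  · exact fricke_ne_zero_of_norm_lt hC (hF x hx) (hF y hy) (hs s h)
  · by_cases h2 : x = 2
    -- For `x = 2` the factor `2 - x` vanishes with equal signs, so the opposite sign is taken.
    · refine ⟨-s, ?_, hmap _ _ _ ?_⟩
      · rcases h with rfl | rfl <;> simp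
      · rw [h2, map_neg, map_ofNat, show fricke (-f s) 2 (f s) = 4 * f s ^ 2 by unfold fricke; ring]
        exact mul_ne_zero (by norm_num) (pow_ne_zero 2 (hpos s h))
    · exact ⟨s, h, hloop s h x hx h2⟩
  · rw [fricke_swap]
    exact hloop t (.inl rfl) x hx h2
  -- The polynomials in `t` below have all their roots among `±1, ±2`. Only two polynomials occur:
  -- `fricke` is symmetric and invariant under changing two signs, so just the parity of the number
  -- of minus signs matters.
  · have hne : ∀ c : ℂ, ‖c‖ ≤ 2 → f t - c ≠ 0 := fun c hc h => by
      rw [sub_eq_zero] at h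
      rw [h] at ht
      nlinarith
    have h1 := hne 1 (by simp)
    have h1' := hne (-1) (by simp)
    have h2 := hne 2 (by simp)
    have h2' := hne (-2) (by simp)
    have e₁ : fricke (f t) (f t) (f t) = -(f t - (-1)) * (f t - 2) ^ 2 := by unfold fricke; ring
    have e₂ : fricke (f t) (f t) (-f t) = (f t - 1) * (f t - (-2)) ^ 2 := by unfold fricke; ring
    have n₁ : fricke (f t) (f t) (f t) ≠ 0 := by
      rw [e₁]
      exact mul_ne_zero (neg_ne_zero.2 h1') (pow_ne_zero 2 h2)
    have n₂ : fricke (f t) (f t) (-f t) ≠ 0 := by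
      rw [e₂]
      exact mul_ne_zero h1 (pow_ne_zero 2 h2')
    rintro s (rfl | rfl) s' (rfl | rfl) s'' (rfl | rfl) <;> refine hmap _ _ _ ?_ <;>
      (try simp only [map_neg]) <;> first
        | exact n₁
        | exact n₂
        | (convert n₁ using 1; unfold fricke; ring1)
        | (convert n₂ using 1; unfold fricke; ring1)

/-- If `f' t = ζ + ζ⁻¹`, then `f' u` is `ζ` or `ζ⁻¹`, so `u` itself is a root of unity and `‖f t‖ ≤
2` at every other embedding `f`. Size at one embedding therefore controls all of them. -/
theorem notMem_rootOfUnityTraces_of_norm_lt {R : Type*} [CommRing R] {t : R} {u : Rˣ}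
    (ht : t = u + (u⁻¹ : Rˣ)) (f f' : R →+* ℂ) (hf' : Function.Injective f') (h : 2 < ‖f t‖) :
    f' t ∉ rootOfUnityTraces := by
  rintro ⟨ζ, ⟨m, hm, hζ⟩, hz⟩
  have hζ₀ : ζ ≠ 0 := by
    rintro rfl
    simp [hm.ne'] at hζ
  have hu : f' u ≠ 0 := (u.map f'.toMonoidHom).ne_zero
  have hinv : ∀ f : R →+* ℂ, f (u⁻¹ : Rˣ) = (f u)⁻¹ := fun f =>
    eq_inv_of_mul_eq_one_right (by rw [← map_mul, Units.mul_inv, map_one])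
  rw [ht, map_add, hinv] at hz
  have hpow : f' u ^ m = 1 := by
    have h' : (f' u - ζ) * (f' u - ζ⁻¹) = 0 := by
      have e₁ := mul_inv_cancel₀ hu
      have e₂ := mul_inv_cancel₀ hζ₀
      linear_combination f' u * hz - e₁ + e₂
    rcases mul_eq_zero.1 h' with h' | h' <;> rw [sub_eq_zero.1 h']
    · exact hζ
    · rw [inv_pow, hζ, inv_one]
  have hpow' : (u : R) ^ m = 1 := hf' (by rw [map_pow, hpow, map_one])
  have hnorm : ‖f u‖ = 1 := Complex.norm_eq_one_of_pow_eq_one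
    (by rw [← map_pow, hpow', map_one]) hm.ne'
  have : ‖f t‖ ≤ 2 := by
    rw [ht, map_add, hinv]
    refine (norm_add_le _ _).trans ?_
    rw [norm_inv, hnorm]
    norm_num
  linarith

/-! ### Quadratic extensions -/

section Quadratic

open IntermediateField

theorem finrank_adjoin_eq_two {K E : Type*} [Field K] [Field E] [Algebra K E] {y : E} {b c : K}
    (hy : y ^ 2 = algebraMap K E b * y + algebraMap K E c) (hmem : y ∉ (algebraMap K E).range) :
    Module.finrank K K⟮y⟯ = 2 := by
  let p : Polynomial K := .X ^ 2 - (.C b * .X + .C c)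
  have hdeg : (Polynomial.C b * .X + .C c).degree < (2 : ℕ) :=
    Polynomial.degree_linear_le.trans_lt (by norm_num)
  have hp : p.Monic := Polynomial.monic_X_pow_sub (n := 2) hdeg
  have hroot : Polynomial.aeval y p = 0 := by simp [p, hy]
  have hint : IsIntegral K y := ⟨p, hp, hroot⟩
  rw [adjoin.finrank hint]
  refine le_antisymm ?_ ((minpoly.two_le_natDegree_iff hint).2 hmem)
  refine (Polynomial.natDegree_le_of_dvd (minpoly.dvd K y hroot) hp.ne_zero).trans ?_
  rw [Polynomial.natDegree_le_iff_degree_le]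
  exact (Polynomial.degree_sub_le _ _).trans (max_le (Polynomial.degree_X_pow_le 2) hdeg.le)

/-- Otherwise `2` would have a `2 ^ d`-th root with `d` the degree over `ℚ`. Taking norms and
`2`-adic valuations gives `2 ^ d ∣ d`, contradicting `d < 2 ^ d`. -/
theorem NumberField.exists_not_isSquare (K : Type*) [Field K] [NumberField K] :
    ∃ d : K, ¬ IsSquare d := by
  by_contra! h
  have hroot : ∀ m : ℕ, ∃ x : K, x ^ 2 ^ m = 2 := by
    intro m
    induction m with
    | zero => exact ⟨2, by simp⟩
    | succ m ih =>
      obtain ⟨x, hx⟩ := ih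
      obtain ⟨y, rfl⟩ := h x
      exact ⟨y, by rw [pow_succ', pow_mul, sq, hx]⟩
  set d := Module.finrank ℚ K with hd
  have hd₀ : 0 < d := Module.finrank_pos
  obtain ⟨x, hx⟩ := hroot d
  have hN : Algebra.norm ℚ x ^ 2 ^ d = 2 ^ d := by
    rw [← map_pow, hx, hd, ← Algebra.norm_algebraMap, map_ofNat (algebraMap ℚ K)]
  have hN₀ : Algebra.norm ℚ x ≠ 0 := by
    intro h
    rw [h, zero_pow (by positivity)] at hN
    exact pow_ne_zero d two_ne_zero hN.symm
  have hv := congrArg (padicValRat 2) hN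
  rw [padicValRat.pow, padicValRat.pow] at hv
  have h2 : padicValRat 2 (2 : ℚ) = 1 := by
    exact_mod_cast padicValRat.self (p := 2) one_lt_two
  rw [h2, mul_one] at hv
  have hdvd : 2 ^ d ∣ d := by
    have : ((2 ^ d : ℕ) : ℤ) ∣ (d : ℤ) := ⟨_, hv.symm⟩
    exact_mod_cast this
  exact (Nat.le_of_dvd hd₀ hdvd).not_gt Nat.lt_two_pow_self

/-- When `u` already lies in `K`, adjoining the square root of a nonsquare keeps the degree exactly
two. -/
theorem NumberField.exists_finrank_eq_two_and_mem {K : Type*} [Field K] [NumberField K]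
    {u : AlgebraicClosure K} {b c : K}
    (hu : u ^ 2 = algebraMap K _ b * u + algebraMap K _ c) :
    ∃ L : IntermediateField K (AlgebraicClosure K), Module.finrank K L = 2 ∧ u ∈ L := by
  by_cases hmem : u ∈ (algebraMap K (AlgebraicClosure K)).range
  · obtain ⟨x, rfl⟩ := hmem
    obtain ⟨d, hd⟩ := NumberField.exists_not_isSquare K
    obtain ⟨y, hy⟩ := IsAlgClosed.exists_pow_nat_eq (algebraMap K (AlgebraicClosure K) d) two_pos
    refine ⟨K⟮y⟯, finrank_adjoin_eq_two (b := 0) (c := d) (by simp [hy]) ?_, _root_.algebraMap_mem K⟮y⟯ x⟩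
    rintro ⟨z, rfl⟩
    refine hd ⟨z, ?_⟩
    rw [← map_pow] at hy
    rw [← sq, (algebraMap K (AlgebraicClosure K)).injective hy]
  · exact ⟨K⟮u⟯, finrank_adjoin_eq_two hu hmem, mem_adjoin_simple_self K u⟩

end Quadratic

/-! ### Large split traces from units of infinite order -/

theorem IsIntegral.of_sq_eq {A : Type*} [CommRing A] {u w : A} (hw : IsIntegral ℤ w)
    (h : u ^ 2 = w * u + 1) : IsIntegral ℤ u := by
  let S := integralClosure ℤ A
  let p : Polynomial S := .X ^ 2 - (.C ⟨w, hw⟩ * .X + .C 1)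
  have hp : p.Monic := Polynomial.monic_X_pow_sub (n := 2)
    (Polynomial.degree_linear_le.trans_lt (by norm_num))
  have hroot : Polynomial.aeval u p = 0 := by
    simp [p, h, Algebra.algebraMap_eq_smul_one, Subalgebra.smul_def]
  exact isIntegral_trans (R := ℤ) (A := S) u ⟨p, hp, hroot⟩

/-- Kronecker: an algebraic integer with all conjugates in the closed unit disc is zero or a root of
unity. -/
theorem NumberField.exists_one_lt_norm {K : Type*} [Field K] [NumberField K] {v : (𝓞 K)ˣ}
    (hv : ¬ IsOfFinOrder v) : ∃ φ : K →+* ℂ, 1 < ‖φ (v : 𝓞 K)‖ := by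
  by_contra! h
  obtain ⟨m, hm, hp⟩ := NumberField.Embeddings.pow_eq_one_of_norm_le_one K ℂ
    (x := ((v : 𝓞 K) : K)) (by simp) (v : 𝓞 K).isIntegral_coe h
  refine hv (isOfFinOrder_iff_pow_eq_one.2 ⟨m, hm, ?_⟩)
  ext
  simpa using hp

/-- A unit of infinite order yields arbitrarily large traces `u + u⁻¹` over the integers of a
quadratic extension, with `u` and `u - u⁻¹` units. -/
theorem NumberField.exists_quadratic_splitTrace {K : Type*} [Field K] [NumberField K] {v : (𝓞 K)ˣ}
    {φ : K →+* ℂ} (hφ : 1 < ‖φ (v : 𝓞 K)‖) {B : ℝ} (hB : 0 ≤ B) :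
    ∃ L : IntermediateField K (AlgebraicClosure K), Module.finrank K L = 2 ∧
      ∃ u : (𝓞 L)ˣ, IsUnit ((u : 𝓞 L) - (u⁻¹ : (𝓞 L)ˣ)) ∧
      ∃ τ : L →+* ℂ, (∀ x : K, τ (algebraMap K L x) = φ x) ∧
        B < ‖τ ((u : 𝓞 L) + (u⁻¹ : (𝓞 L)ˣ) : 𝓞 L)‖ := by
  obtain ⟨m, hm⟩ := pow_unbounded_of_one_lt (B + 2) hφ
  set w : (𝓞 K)ˣ := v ^ m with hw
  have hφw : B + 2 < ‖φ (w : 𝓞 K)‖ := by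
    rw [hw]
    simpa using hm
  -- `w² + 4` is the discriminant of `X² - w X - 1`, whose roots satisfy `y - y⁻¹ = w`.
  obtain ⟨s, hs⟩ := IsAlgClosed.exists_pow_nat_eq
    (algebraMap K (AlgebraicClosure K) ((w : 𝓞 K) ^ 2 + 4)) two_pos
  obtain ⟨y, hy⟩ : ∃ y : AlgebraicClosure K,
      y ^ 2 = algebraMap K _ (w : 𝓞 K) * y + algebraMap K _ 1 := by
    refine ⟨(algebraMap K _ (w : 𝓞 K) + s) / 2, ?_⟩
    rw [map_add, map_pow, map_ofNat] at hs
    rw [map_one]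
    linear_combination hs / 4
  obtain ⟨L, hL, hyL⟩ := NumberField.exists_finrank_eq_two_and_mem hy
  let wL : 𝓞 L := algebraMap (𝓞 K) (𝓞 L) w
  have hwL : (wL : L) = algebraMap K L (w : 𝓞 K) := rfl
  have hyL' : (⟨y, hyL⟩ : L) ^ 2 = (wL : L) * ⟨y, hyL⟩ + 1 := by
    rw [hwL]
    apply Subtype.ext
    simpa using hy
  let uL : 𝓞 L := ⟨⟨y, hyL⟩, IsIntegral.of_sq_eq wL.2 hyL'⟩
  have huL : uL ^ 2 = wL * uL + 1 := NumberField.RingOfIntegers.ext hyL'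
  let u : (𝓞 L)ˣ := ⟨uL, uL - wL, by linear_combination huL, by linear_combination huL⟩
  let _ := φ.toAlgebra
  let τ : L →ₐ[K] ℂ := IsAlgClosed.lift
  have hτ : ∀ x : K, τ (algebraMap K L x) = φ x := τ.commutes
  refine ⟨L, hL, u, ?_, τ.toRingHom, hτ, ?_⟩
  · have : (u : 𝓞 L) - (u⁻¹ : (𝓞 L)ˣ) = wL := sub_sub_cancel uL wL
    rw [this]
    exact w.isUnit.map (algebraMap (𝓞 K) (𝓞 L))
  · obtain ⟨t, ht⟩ : ∃ t : 𝓞 L, t = (u : 𝓞 L) + (u⁻¹ : (𝓞 L)ˣ) := ⟨_, rfl⟩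
    have ht' : t ^ 2 = wL ^ 2 + 4 := by
      rw [ht]
      change (uL + (uL - wL)) ^ 2 = _
      linear_combination 4 * huL
    rw [← ht]
    have hτt : τ (t : L) ^ 2 = φ (w : 𝓞 K) ^ 2 + 4 := by
      have h : (t : L) ^ 2 = (wL : L) ^ 2 + 4 := congrArg (fun x : 𝓞 L => (x : L)) ht'
      rw [← hτ, ← hwL, ← map_pow, h, map_add, map_pow, map_ofNat]
    -- From `t² = w² + 4`; with `‖φ w‖ > B + 2` this forces `‖τ t‖ > B`.
    have hn : ‖φ (w : 𝓞 K)‖ ^ 2 ≤ ‖τ (t : L)‖ ^ 2 + 4 := by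
      rw [← norm_pow, ← norm_pow, hτt]
      have := norm_sub_le (φ (w : 𝓞 K) ^ 2 + 4) 4
      simpa using this
    change B < ‖τ (t : L)‖
    by_contra! h
    nlinarith [norm_nonneg (τ (t : L))]

/-! ### Assembly -/

theorem mainTheorem7 (g n : ℕ) (hgn : 3 < 3 * g + n)
    (K : Type*) [Field K] [NumberField K]
    (hK : ∃ v : (𝓞 K)ˣ, ¬ IsOfFinOrder v ∧ IsUnit ((v : 𝓞 K) - ((v⁻¹ : (𝓞 K)ˣ) : 𝓞 K)))
    (k : Fin n → 𝓞 K) :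
    ∃ (L : IntermediateField K (AlgebraicClosure K)),
      Module.finrank K L = 2 ∧
      ∃ (P : PantsDecomposition g n) (ρ : SurfaceGroup g n →* SL(2, 𝓞 L)),
        (∀ j : Fin n, (ρ (punctureLoop j) : Matrix (Fin 2) (Fin 2) (𝓞 L)).trace =
          algebraMap (𝓞 K) (𝓞 L) (k j)) ∧
        ∀ σ : L →+* ℂ, P.IsGood (complexRep ρ σ) := by
  obtain ⟨v, hv, -⟩ := hK
  obtain ⟨φ, hφ⟩ := NumberField.exists_one_lt_norm hv
  obtain ⟨C, hC⟩ : ∃ C : ℝ, C = 1 + ∑ j, ‖φ (k j)‖ := ⟨_, rfl⟩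
  have hC₁ : 1 ≤ C := by
    rw [hC]
    exact le_add_of_nonneg_right (Finset.sum_nonneg fun j _ => norm_nonneg _)
  have hkC : ∀ j, ‖φ (k j)‖ ≤ C := fun j => by
    have := Finset.single_le_sum (f := fun j => ‖φ (k j)‖) (fun j _ => norm_nonneg _)
      (Finset.mem_univ j)
    linarith
  obtain ⟨L, hL, u, hu, τ, hτ, hlarge⟩ :=
    NumberField.exists_quadratic_splitTrace hφ (B := 3 * C ^ 2 + 5) (by positivity)
  refine ⟨L, hL, ?_⟩
  obtain ⟨t, ht⟩ : ∃ t : 𝓞 L, t = (u : 𝓞 L) + (u⁻¹ : (𝓞 L)ˣ) := ⟨_, rfl⟩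
  rw [← ht] at hlarge
  have hinj : ∀ σ : L →+* ℂ, Function.Injective (σ.comp (algebraMap (𝓞 L) L)) := fun σ =>
    σ.injective.comp NumberField.RingOfIntegers.coe_injective
  let k' : Fin n → 𝓞 L := fun j => algebraMap (𝓞 K) (𝓞 L) (k j)
  have hsplit : PantsDecomposition.IsSplitTrace t := ⟨u, ht, hu⟩
  have hgen : IsGenericTrace t (Set.range k') := by
    refine isGenericTrace_of_norm_lt (τ.comp (algebraMap (𝓞 L) L)) (hinj τ) hC₁ ?_ hlarge
    rintro _ ⟨j, rfl⟩
    have : τ.comp (algebraMap (𝓞 L) L) (k' j) = φ (k j) := hτ (k j)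
    rw [this]
    exact hkC j
  have hE : ∀ σ : L →+* ℂ, σ.comp (algebraMap (𝓞 L) L) t ∉ rootOfUnityTraces := fun σ =>
    notMem_rootOfUnityTraces_of_norm_lt ht (τ.comp (algebraMap (𝓞 L) L)) _ (hinj σ)
      (lt_of_le_of_lt (by nlinarith) hlarge)
  suffices ∃ (P : PantsDecomposition g n) (ρ : SurfaceGroup g n →* SL(2, 𝓞 L)),
      P.Realizes t k' ρ ∧ (P.Nondegenerate ρ ∨ (g = 1 ∧ n = 1 ∧ ∀ j, k' j = 2)) by
    obtain ⟨P, ρ, h, hN⟩ := this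
    exact ⟨P, ρ, h.trace_punctureLoop, fun σ => h.isGood_map (hinj σ) (hE σ) hN⟩
  -- In the one-holed torus the two seam sides are the same curve, so the single pair of pants has
  -- traces `t, t, k 0` and its `fricke` value has the factor `2 - k 0`.
  by_cases h11 : g = 1 ∧ n = 1
  · obtain ⟨rfl, rfl⟩ := h11
    obtain ⟨P, ρ, h, hN⟩ := PantsDecomposition.exists_realizes_torus hsplit k'
    refine ⟨P, ρ, h, ?_⟩
    by_cases h2 : k' 0 = 2
    · exact .inr ⟨rfl, rfl, fun j => by rwa [Subsingleton.elim j 0]⟩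
    · exact .inl (hN (hgen.loop _ ⟨0, rfl⟩ h2))
  · obtain ⟨P, ρ, h, hN⟩ := PantsDecomposition.realizable hsplit hgen (g := g) (by omega)
      (k := k') (fun j => ⟨j, rfl⟩)
    exact ⟨P, ρ, h, .inl hN⟩
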